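/- Let $T,\delta>0$, $\sigma_1,\sigma_2>0$, $x_0,y_0\in\mathbb R$, $\rho\in[-1,1]$ and $\vartheta\in\Theta:=(-\delta,\delta)$. On a filtered probability space let $(B^{(1)},B^{(2)})$ be a two-dimensional Brownian motion over the time set $[-\delta,T+\delta]$ (increments adapted and independent of the past, $B_0=0$) with $\langle B^{(1)},B^{(2)}\rangle_t=\rho t$. The lead-lag Bachelier model with parameter $\vartheta$ is, for $t\in[0,T+\delta]$, $X_t=x_0+\sigma_1B^{(1)}_t$, $Y_t=y_0+\sigma_2B^{(2)}_{t-\vartheta}$ if $\vartheta\ge0$, and $X_t=x_0+\sigma_1B^{(1)}_{t+\vartheta}$, $Y_t=y_0+\sigma_2B^{(2)}_t$ if $\vartheta<0$. Both components are observed at the times $i\Delta_n\in[0,T+\delta]$, $i=0,1,2,\dots$, where $\Delta_n>0$ is deterministic and $\Delta_n\to0$. Let $\mathcal I_n$ be the family of intervals $((i-1)\Delta_n,i\Delta_n]$, $i\geq 1$, contained in $[0,T+\delta]$; for $H=(a,b]$ write $H_\theta=(a+\theta,b+\theta]$, $\overline H=b$ and $Z(H)=Z_b-Z_a$. For $\theta\in\Theta$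 let $$\mathcal U^n(\theta)=\sum_{I,J\in\mathcal I_n,\ \overline I\le T}X(I)Y(J)1_{\{I\cap J_{-\theta}\ne\varnothing\}}\ (\theta\ge0),\qquad \mathcal U^n(\theta)=\sum_{I,J\in\mathcal I_n,\ \overline J\le T}X(I)Y(J)1_{\{J\cap I_{\theta}\ne\varnothing\}}\ (\theta<0)$$ be the shifted Hayashi–Yoshida contrast, and let $$\mathcal V^n(\theta)=\sum_{I\in\mathcal I_n,\ \overline I\le T}X(I)\,Y(I_\theta)\ (\theta\ge0),\qquad \mathcal V^n(\theta)=\sum_{J\in\mathcal I_n,\ \overline J\le T}X(J_{-\theta})\,Y(J)\ (\theta<0)$$ be the shifted covariation with matched increments. Let $\varphi(t)=(1-|t|)1_{|t|\le1}$. Let $\tilde\vartheta=\tilde\vartheta_n\in\Theta$ satisfy $|\tilde\vartheta_n-\vartheta|\le\Delta_n$ for all $n$. Then there are random variables $\xi^n$, converging in distribution to the standard Gaussian law $\mathcal N(0,1)$ as $n\to\infty$, such that for every $n$ $$\mathcal V^n(\tilde\vartheta)=\sigma_1\sigma_2\Bigl(T\rho\,\varphi\bigl(\Delta_n^{-1}(\tilde\vartheta-\vartheta)\bigr)+T^{1/2}\Delta_n^{1/2}\sqrt{1+\rho^2\varphi\bigl(\Delta_n^{-1}(\tilde\vartheta-\vartheta)\bigr)^2}\;\xi^n\Bigr),$$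 and, for every $n$ for which $\tilde\vartheta_n$ is an integer multiple of the sampling step $\Delta_n$, the same identity (with the same $\xi^n$) holds with $\mathcal U^n(\tilde\vartheta)$ in place of $\mathcal V^n(\tilde\vartheta)$. -/

import Mathlib

open MeasureTheory ProbabilityTheory Filter Topology

namespace LeadLag

/-- `(B₁, B₂)` is a two-dimensional `𝓕`-Brownian motion with correlation `ρ`
(that is, `⟨B₁, B₂⟩_t = ρ t`) over the set of times `S`, which contains `0` and may contain
negative times. Since `S` may start before time `0`, at which the motion is normalized to vanish,
it is the increments that are adapted (for `0 ≤ t` the values at time `t` then are so as well,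
up to the almost sure normalization). -/
structure IsCorrelatedBrownian {Ω : Type*} {mΩ : MeasurableSpace Ω} (P : Measure Ω)
    (𝓕 : Filtration ℝ mΩ) (S : Set ℝ) (ρ : ℝ) (B₁ B₂ : ℝ → Ω → ℝ) : Prop where
  zero_mem : (0 : ℝ) ∈ S
  zero_fst : ∀ᵐ ω ∂P, B₁ 0 ω = 0
  zero_snd : ∀ᵐ ω ∂P, B₂ 0 ω = 0
  /-- the increments up to time `t` are `𝓕 t`-measurable -/
  adapted : ∀ s ∈ S, ∀ t ∈ S, s ≤ t →
    Measurable[𝓕 t] (fun ω ↦ (B₁ t ω - B₁ s ω, B₂ t ω - B₂ s ω))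
  /-- the increments after time `s` are independent of `𝓕 s` -/
  indep : ∀ s ∈ S, ∀ t ∈ S, s ≤ t →
    Indep (MeasurableSpace.comap (fun ω ↦ (B₁ t ω - B₁ s ω, B₂ t ω - B₂ s ω)) inferInstance)
      (𝓕 s) P
  /-- the increment over `(s, t]` is centred Gaussian with covariance matrix
  `(t - s) • !![1, ρ; ρ, 1]`: it is distributed as `(U, ρ U + √(1 - ρ²) V)` for independent
  `U, V` with law `N(0, t - s)` -/
  hasLaw : ∀ s ∈ S, ∀ t ∈ S, s ≤ t →
    HasLaw (fun ω ↦ (B₁ t ω - B₁ s ω, B₂ t ω - B₂ s ω))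
      (((gaussianReal 0 (t - s).toNNReal).prod (gaussianReal 0 (t - s).toNNReal)).map
        (fun p : ℝ × ℝ ↦ (p.1, ρ * p.1 + √(1 - ρ ^ 2) * p.2))) P
  /-- almost surely, the paths are continuous -/
  continuous_paths : ∀ᵐ ω ∂P, ContinuousOn (fun t ↦ B₁ t ω) S ∧ ContinuousOn (fun t ↦ B₂ t ω) S

/-- First component of the lead-lag Bachelier model with lead-lag parameter `ϑ`:
`X_t = x₀ + σ₁ B₁(t)` for `0 ≤ ϑ`, and (roles intertwined)
`X_t = x₀ + σ₁ B₁(t - |ϑ|)` for `ϑ < 0`. -/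
noncomputable def bachelierX {Ω : Type*} (x₀ σ₁ ϑ : ℝ) (B₁ : ℝ → Ω → ℝ) (t : ℝ) (ω : Ω) : ℝ :=
  x₀ + σ₁ * B₁ (t - max (-ϑ) 0) ω

/-- Second component of the lead-lag Bachelier model with lead-lag parameter `ϑ`:
`Y_t = y₀ + σ₂ B₂(t - ϑ)` for `0 ≤ ϑ`, and (roles intertwined)
`Y_t = y₀ + σ₂ B₂(t)` for `ϑ < 0`. -/
noncomputable def bachelierY {Ω : Type*} (y₀ σ₂ ϑ : ℝ) (B₂ : ℝ → Ω → ℝ) (t : ℝ) (ω : Ω) : ℝ :=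
  y₀ + σ₂ * B₂ (t - max ϑ 0) ω

/-- The interval `H + θ`; the pair `H` stands for the interval `(H.1, H.2]`. -/
def shiftInterval (H : ℝ × ℝ) (θ : ℝ) : ℝ × ℝ := (H.1 + θ, H.2 + θ)

/-- The increment `Z(H)` of the process `Z` over the interval `H = (H.1, H.2]`. -/
def increment {Ω : Type*} (Z : ℝ → Ω → ℝ) (H : ℝ × ℝ) (ω : Ω) : ℝ := Z H.2 ω - Z H.1 ω

open Classical in
/-- The shifted Hayashi-Yoshida covariation contrast
`U(θ) = ∑_{I, J, sup I ≤ T} X(I) Y(J) 1{I ∩ J_{-θ} ≠ ∅}` for `0 ≤ θ`, and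
`U(θ) = ∑_{I, J, sup J ≤ T} X(I) Y(J) 1{J ∩ I_θ ≠ ∅}` for `θ < 0`. -/
noncomputable def hyContrast {Ω : Type*} (T : ℝ) (𝓘 𝓙 : Finset (ℝ × ℝ)) (X Y : ℝ → Ω → ℝ)
    (θ : ℝ) (ω : Ω) : ℝ :=
  if 0 ≤ θ then
    ∑ I ∈ 𝓘, ∑ J ∈ 𝓙,
      if I.2 ≤ T ∧
          (Set.Ioc I.1 I.2 ∩
            Set.Ioc (shiftInterval J (-θ)).1 (shiftInterval J (-θ)).2).Nonempty
      then increment X I ω * increment Y J ω else 0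
  else
    ∑ I ∈ 𝓘, ∑ J ∈ 𝓙,
      if J.2 ≤ T ∧
          (Set.Ioc J.1 J.2 ∩
            Set.Ioc (shiftInterval I θ).1 (shiftInterval I θ).2).Nonempty
      then increment X I ω * increment Y J ω else 0

/-- The shifted realized covariation over a common subdivision, the increments of one component
being matched with the increments of the other one over the shifted intervals:
`∑_{I, sup I ≤ T} X(I) Y(I_θ)` for `0 ≤ θ`, and
`∑_{J, sup J ≤ T} X(J_{-θ}) Y(J)` for `θ < 0`. -/
noncomputable def shiftedCovariation {Ω : Type*} (T : ℝ) (𝓘 : Finset (ℝ × ℝ))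
    (X Y : ℝ → Ω → ℝ) (θ : ℝ) (ω : Ω) : ℝ :=
  if 0 ≤ θ then
    ∑ I ∈ 𝓘, if I.2 ≤ T then increment X I ω * increment Y (shiftInterval I θ) ω else 0
  else
    ∑ J ∈ 𝓘, if J.2 ≤ T then increment X (shiftInterval J (-θ)) ω * increment Y J ω else 0

/-- The intervals `(i Δ, (i + 1) Δ]`, `i = 0, 1, 2, …`, that are contained in `[0, L]`. -/
noncomputable def equispaced (Δ L : ℝ) : Finset (ℝ × ℝ) :=
  (Finset.range ⌊L / Δ⌋₊).image (fun i : ℕ ↦ ((i : ℝ) * Δ, ((i : ℝ) + 1) * Δ))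

/-- The hat function `φ(t) = (1 - |t|) 1{|t| ≤ 1}`. -/
noncomputable def hat (t : ℝ) : ℝ := if |t| ≤ 1 then 1 - |t| else 0

end LeadLag

namespace LeadLag

/-! In Brownian time the matched increments lie on two grids of mesh `Δ` that differ by `τ = θ - ϑ`,
with `|τ| ≤ Δ` (`exists_shiftedCovariation_eq`). Merging the grids cuts time into cells of lengths
`|τ|` and `Δ - |τ|` in alternation, on which the Brownian increments are independent Gaussian pairs.
Each product involves three consecutive cells and its two factors share the middle one, so its mean
is `ρ (Δ - |τ|) = ρ Δ φ` and its variance `Δ² (1 + ρ² φ²)` (`integral_overlapTerm_sq`).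

Two neighbouring products share one cell, so the centred products are one-dependent; they are
nevertheless uncorrelated (`integral_overlapTerm_mul_succ`), hence the variances simply add up. The
central limit theorem is proved with characteristic functions: adding one term multiplies the
characteristic function of the partial sum by `1 - v u² / 2`, up to `O(|u|³)`
(`norm_integral_step_le`). With about `T / Δ` terms and `u` of order `√Δ`, the accumulated error
vanishes and the Gaussian characteristic function remains
(`tendsto_integral_cexp_of_isOneDependent`).

The variable `ξ` is the normalized sum plus a deterministic `O(√Δ)` shift, which pays for centring
at `T` instead of `⌊T / Δ⌋ Δ`. When the shift is a multiple of the step, shifted grid intervals are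
again grid intervals, and the Hayashi-Yoshida contrast is the same sum
(`hyContrast_eq_shiftedCovariation`). -/

/-! ### Taylor estimates for the complex exponential. -/

lemma norm_cexp_sub_taylor_one_le (x : ℝ) :
    ‖Complex.exp (Complex.I * x) - (1 + Complex.I * x)‖ ≤ 3 * |x| ^ 2 := by
  have hn : ‖Complex.I * (x : ℂ)‖ = |x| := by simp
  rcases le_total |x| 1 with h | h
  · have := Complex.norm_exp_sub_one_sub_id_le (x := Complex.I * x) (by rw [hn]; exact h)
    rw [hn] at this
    calc _ = ‖Complex.exp (Complex.I * x) - 1 - Complex.I * x‖ := by congr 1; ring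
      _ ≤ _ := by nlinarith [sq_nonneg |x|]
  · calc _ ≤ ‖Complex.exp (Complex.I * x)‖ + (‖(1 : ℂ)‖ + ‖Complex.I * (x : ℂ)‖) :=
          (norm_sub_le _ _).trans (add_le_add le_rfl (norm_add_le _ _))
      _ = 2 + |x| := by rw [Complex.norm_exp_I_mul_ofReal, hn]; norm_num; ring
      _ ≤ _ := by nlinarith

lemma norm_cexp_sub_taylor_two_le (x : ℝ) :
    ‖Complex.exp (Complex.I * x) - (1 + Complex.I * x - x ^ 2 / 2)‖ ≤ 4 * |x| ^ 3 := by
  have hn : ‖Complex.I * (x : ℂ)‖ = |x| := by simp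
  have hI : (Complex.I * (x : ℂ)) ^ 2 = -x ^ 2 := by rw [mul_pow, Complex.I_sq]; ring
  have h3 : 0 ≤ |x| ^ 3 := by positivity
  rcases le_total |x| 1 with h | h
  · have := Complex.exp_bound (x := Complex.I * x) (by rw [hn]; exact h) (n := 3) (by norm_num)
    rw [hn] at this
    simp only [Finset.sum_range_succ, Finset.sum_range_zero, hI] at this
    norm_num [Nat.factorial] at this
    calc _ = ‖Complex.exp (Complex.I * x) - (1 + Complex.I * x + -(x : ℂ) ^ 2 / 2)‖ := by
          congr 1; ring
      _ ≤ _ := by nlinarith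
  · have h2 : ‖(x : ℂ) ^ 2 / 2‖ = |x| ^ 2 / 2 := by simp
    calc _ ≤ ‖Complex.exp (Complex.I * x)‖ +
            ((‖(1 : ℂ)‖ + ‖Complex.I * (x : ℂ)‖) + ‖(x : ℂ) ^ 2 / 2‖) :=
          (norm_sub_le _ _).trans (add_le_add le_rfl ((norm_sub_le _ _).trans
            (add_le_add (norm_add_le _ _) le_rfl)))
      _ = 2 + |x| + |x| ^ 2 / 2 := by
          rw [Complex.norm_exp_I_mul_ofReal, hn, h2]; norm_num; ring
      _ ≤ _ := by
          have h2 : |x| ≤ |x| ^ 2 := by nlinarith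
          have h3 : |x| ^ 2 ≤ |x| ^ 3 := by nlinarith [sq_nonneg |x|]
          linarith

lemma abs_one_sub_sub_exp_neg_le {x : ℝ} (hx : 0 ≤ x) : |1 - x - Real.exp (-x)| ≤ x ^ 2 := by
  rcases le_total x 1 with h | h
  · have := Real.abs_exp_sub_one_sub_id_le (x := -x) (by rwa [abs_neg, abs_of_nonneg hx])
    rw [abs_sub_comm]
    calc _ = |Real.exp (-x) - 1 - -x| := by congr 1; ring
      _ ≤ _ := by simpa using this
  · have h1 : Real.exp (-x) ≤ 1 := Real.exp_le_one_iff.2 (by linarith)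
    have h2 := Real.exp_pos (-x)
    rw [abs_le]
    constructor <;> nlinarith

lemma mul_sq_le_cube_add {a b : ℝ} (ha : 0 ≤ a) (hb : 0 ≤ b) : a * b ^ 2 ≤ a ^ 3 + b ^ 3 := by
  rcases le_total a b with h | h
  · have : a * b ^ 2 ≤ b * b ^ 2 := by gcongr
    nlinarith [pow_nonneg ha 3]
  · have : a * b ^ 2 ≤ a * a ^ 2 := by gcongr
    nlinarith [pow_nonneg hb 3]

lemma mul_mul_le_cube_add {a b c : ℝ} (ha : 0 ≤ a) (hb : 0 ≤ b) (hc : 0 ≤ c) :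
    a * b * c ≤ a ^ 3 + b ^ 3 + c ^ 3 := by
  have h1 := mul_sq_le_cube_add ha hb
  have h2 := mul_sq_le_cube_add ha hc
  have : a * b * c ≤ (a * b ^ 2 + a * c ^ 2) / 2 := by nlinarith [mul_nonneg ha (sq_nonneg (b - c))]
  nlinarith [pow_nonneg ha 3, pow_nonneg hb 3, pow_nonneg hc 3]

lemma le_one_add_cube {a : ℝ} (ha : 0 ≤ a) : a ≤ 1 + a ^ 3 := by
  rcases le_total a 1 with h | h
  · nlinarith [pow_nonneg ha 3]
  · nlinarith [sq_nonneg a, mul_nonneg ha (mul_nonneg (sub_nonneg.2 h) (by linarith : 0 ≤ a + 1))]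

/-- Pointwise expansion of one step of the characteristic function of a one-dependent sum. -/
lemma norm_cexp_step_le (u v a b c : ℝ) (hv : 0 ≤ v) (z : ℂ) (hz : ‖z‖ = 1) :
    ‖z * Complex.exp (Complex.I * (u * a : ℝ)) * Complex.exp (Complex.I * (u * b : ℝ)) *
          Complex.exp (Complex.I * (u * c : ℝ))
        - (1 - v * u ^ 2 / 2 : ℝ) * (z * Complex.exp (Complex.I * (u * a : ℝ)) *
          Complex.exp (Complex.I * (u * b : ℝ)))
        - (Complex.I * u * (z * Complex.exp (Complex.I * (u * a : ℝ)) * c)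
          - u ^ 2 * (z * (b * c : ℝ))
          - u ^ 2 / 2 * (z * Complex.exp (Complex.I * (u * a : ℝ)) * (c ^ 2 - v : ℝ)))‖
      ≤ |u| ^ 3 * (10 * (|a| ^ 3 + |b| ^ 3 + |c| ^ 3) + v * (1 + |b| ^ 3)) := by
  set E₁ := Complex.exp (Complex.I * (u * a : ℝ)) with hE₁
  set E₂ := Complex.exp (Complex.I * (u * b : ℝ)) with hE₂
  set E₃ := Complex.exp (Complex.I * (u * c : ℝ)) with hE₃
  have n1 : ‖E₁‖ = 1 := Complex.norm_exp_I_mul_ofReal _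
  have n2 : ‖E₂‖ = 1 := Complex.norm_exp_I_mul_ofReal _
  have d1 : ‖E₁ - 1‖ ≤ |u| * |a| := by
    rw [← abs_mul]; exact Real.norm_exp_I_mul_ofReal_sub_one_le (x := u * a)
  have d2 : ‖E₂ - 1‖ ≤ |u| * |b| := by
    rw [← abs_mul]; exact Real.norm_exp_I_mul_ofReal_sub_one_le (x := u * b)
  have q2 : ‖E₂ - (1 + Complex.I * (u * b : ℝ))‖ ≤ 3 * (|u| * |b|) ^ 2 := by
    rw [← abs_mul]; exact norm_cexp_sub_taylor_one_le (u * b)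
  have r3 : ‖E₃ - (1 + Complex.I * (u * c : ℝ) - (u * c : ℝ) ^ 2 / 2)‖ ≤ 4 * (|u| * |c|) ^ 3 := by
    rw [← abs_mul]; exact norm_cexp_sub_taylor_two_le (u * c)
  -- The last factor is expanded to second order. In the term linear in `c`, `E₂` is expanded to
  -- first order; in the resulting `b c` term `E₁` is replaced by `1`, and in the `c²` and `v` terms
  -- `E₂` is. Each replacement leaves a remainder of order `|u|³`.
  have key : z * E₁ * E₂ * E₃ - (1 - v * u ^ 2 / 2 : ℝ) * (z * E₁ * E₂)
        - (Complex.I * u * (z * E₁ * c) - u ^ 2 * (z * (b * c : ℝ))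
          - u ^ 2 / 2 * (z * E₁ * (c ^ 2 - v : ℝ)))
      = z * E₁ * E₂ * (E₃ - (1 + Complex.I * (u * c : ℝ) - (u * c : ℝ) ^ 2 / 2))
        + Complex.I * u * c * z * E₁ * (E₂ - (1 + Complex.I * (u * b : ℝ)))
        - u ^ 2 * z * (E₁ - 1) * b * c
        - u ^ 2 / 2 * z * E₁ * (E₂ - 1) * c ^ 2
        + v * u ^ 2 / 2 * z * E₁ * (E₂ - 1) := by
    push_cast
    linear_combination (u ^ 2 * b * c * z * E₁ : ℂ) * Complex.I_sq
  rw [key]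
  have t1 : ‖z * E₁ * E₂ * (E₃ - (1 + Complex.I * (u * c : ℝ) - (u * c : ℝ) ^ 2 / 2))‖
      ≤ 4 * (|u| * |c|) ^ 3 := by
    rw [norm_mul, norm_mul, norm_mul, hz, n1, n2]; simpa using r3
  have t2 : ‖Complex.I * u * c * z * E₁ * (E₂ - (1 + Complex.I * (u * b : ℝ)))‖
      ≤ |u| * |c| * (3 * (|u| * |b|) ^ 2) := by
    rw [norm_mul, norm_mul, norm_mul, norm_mul, norm_mul, hz, n1]
    simp only [Complex.norm_I, Complex.norm_real, Real.norm_eq_abs, one_mul, mul_one]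
    gcongr
  have t3 : ‖(u : ℂ) ^ 2 * z * (E₁ - 1) * b * c‖ ≤ |u| ^ 2 * (|u| * |a|) * |b| * |c| := by
    rw [norm_mul, norm_mul, norm_mul, norm_mul, norm_pow, hz]
    simp only [Complex.norm_real, Real.norm_eq_abs, mul_one]
    gcongr
  have t4 : ‖(u : ℂ) ^ 2 / 2 * z * E₁ * (E₂ - 1) * c ^ 2‖
      ≤ |u| ^ 2 / 2 * (|u| * |b|) * |c| ^ 2 := by
    rw [norm_mul, norm_mul, norm_mul, norm_mul, norm_div, norm_pow, norm_pow, hz, n1]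
    simp only [Complex.norm_real, Real.norm_eq_abs, mul_one, Complex.norm_ofNat]
    gcongr
  have t5 : ‖(v : ℂ) * u ^ 2 / 2 * z * E₁ * (E₂ - 1)‖ ≤ v * |u| ^ 2 / 2 * (|u| * |b|) := by
    rw [norm_mul, norm_mul, norm_mul, norm_div, norm_mul, norm_pow, hz, n1]
    simp only [Complex.norm_real, Real.norm_eq_abs, mul_one, Complex.norm_ofNat, abs_of_nonneg hv]
    gcongr
  have hu : 0 ≤ |u| := abs_nonneg u
  have ha : 0 ≤ |a| := abs_nonneg a
  have hb : 0 ≤ |b| := abs_nonneg b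
  have hc : 0 ≤ |c| := abs_nonneg c
  have m1 := mul_sq_le_cube_add hc hb
  have m2 := mul_mul_le_cube_add ha hb hc
  have m3 := mul_sq_le_cube_add hb hc
  have m4 : v * |b| ≤ v * (1 + |b| ^ 3) := by gcongr; exact le_one_add_cube hb
  have m5 : 0 ≤ v * |b| := by positivity
  have a3 := pow_nonneg ha 3
  have b3 := pow_nonneg hb 3
  have c3 := pow_nonneg hc 3
  refine ((norm_add_le _ _).trans (add_le_add ((norm_sub_le _ _).trans (add_le_add
    ((norm_sub_le _ _).trans (add_le_add ((norm_add_le _ _).trans (add_le_add t1 t2)) t3)) t4))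
    t5)).trans ?_
  calc _ = |u| ^ 3 * (4 * |c| ^ 3 + 3 * (|c| * |b| ^ 2) + |a| * |b| * |c| + |b| * |c| ^ 2 / 2
        + v * |b| / 2) := by ring
    _ ≤ _ := by
      refine mul_le_mul_of_nonneg_left ?_ (by positivity)
      linarith

/-! ### Characteristic functions of sums of one-dependent, uncorrelated variables. -/

section OneDependent

variable {Ω : Type*} {mΩ : MeasurableSpace Ω} {P : Measure Ω}

/-- The first `N` terms of `X` are centred with variance `v`, consecutive ones are uncorrelated,
third absolute moments are at most `K`, and partial sums are independent of the two terms that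
follow the next one. -/
structure IsOneDependent (P : Measure Ω) (X : ℕ → Ω → ℝ) (N : ℕ) (v K : ℝ) : Prop where
  measurable : ∀ i, Measurable (X i)
  integrable : ∀ i < N, Integrable (fun ω ↦ |X i ω| ^ 3) P
  third_moment : ∀ i < N, ∫ ω, |X i ω| ^ 3 ∂P ≤ K
  mean : ∀ i < N, ∫ ω, X i ω ∂P = 0
  second_moment : ∀ i < N, ∫ ω, X i ω ^ 2 ∂P = v
  cov : ∀ i, i + 1 < N → ∫ ω, X i ω * X (i + 1) ω ∂P = 0
  indep : ∀ k, IndepFun (fun ω ↦ ∑ i ∈ Finset.range k, X i ω)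
    (fun ω ↦ (X (k + 1) ω, X (k + 2) ω)) P

namespace IsOneDependent

variable {X : ℕ → Ω → ℝ} {N : ℕ} {v K : ℝ}

lemma measurable_sum (h : IsOneDependent P X N v K) (k : ℕ) :
    Measurable (fun ω ↦ ∑ i ∈ Finset.range k, X i ω) :=
  Finset.measurable_fun_sum _ fun i _ ↦ h.measurable i

lemma measurable_cexp (h : IsOneDependent P X N v K) (u : ℝ) (k : ℕ) :
    Measurable (fun ω ↦ Complex.exp (Complex.I * (u * ∑ i ∈ Finset.range k, X i ω : ℝ))) := by
  have := h.measurable_sum k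
  fun_prop

lemma integrable_cexp_mul (h : IsOneDependent P X N v K) (u : ℝ) (k : ℕ) {g : Ω → ℝ}
    (hg : Integrable g P) :
    Integrable (fun ω ↦ Complex.exp (Complex.I * (u * ∑ i ∈ Finset.range k, X i ω : ℝ)) * g ω)
      P := by
  refine hg.ofReal.bdd_mul (c := 1) (h.measurable_cexp u k).aestronglyMeasurable ?_
  exact ae_of_all _ fun ω ↦ (Complex.norm_exp_I_mul_ofReal _).le

lemma memLp_three (h : IsOneDependent P X N v K) {i : ℕ} (hi : i < N) : MemLp (X i) 3 P := by
  rw [← integrable_norm_rpow_iff (h.measurable i).aestronglyMeasurable (by norm_num) (by norm_num)]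
  simpa using h.integrable i hi

/-- Leaving out the term of index `k` makes the exponential exactly independent of the two terms
that follow it. -/
lemma integral_cexp_mul_comp (h : IsOneDependent P X N v K) (u : ℝ) (k : ℕ)
    {f : ℝ × ℝ → ℝ} (hf : Measurable f) :
    ∫ ω, Complex.exp (Complex.I * (u * ∑ i ∈ Finset.range k, X i ω : ℝ)) *
        (f (X (k + 1) ω, X (k + 2) ω) : ℂ) ∂P
      = (∫ ω, Complex.exp (Complex.I * (u * ∑ i ∈ Finset.range k, X i ω : ℝ)) ∂P) *
        ((∫ ω, f (X (k + 1) ω, X (k + 2) ω) ∂P : ℝ) : ℂ) := by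
  rw [← integral_complex_ofReal]
  refine (h.indep k).integral_fun_comp_mul_comp
    (f := fun s : ℝ ↦ Complex.exp (Complex.I * (u * s : ℝ))) (g := fun x ↦ (f x : ℂ))
    (h.measurable_sum k).aemeasurable
    ((h.measurable _).prodMk (h.measurable _)).aemeasurable ?_ ?_
  · exact Measurable.aestronglyMeasurable (by fun_prop)
  · exact Measurable.aestronglyMeasurable (by fun_prop)

variable [IsProbabilityMeasure P]

lemma integrable_self (h : IsOneDependent P X N v K) {i : ℕ} (hi : i < N) :
    Integrable (X i) P :=
  (h.memLp_three hi).integrable (by norm_num)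

lemma memLp_two (h : IsOneDependent P X N v K) {i : ℕ} (hi : i < N) : MemLp (X i) 2 P :=
  (h.memLp_three hi).mono_exponent (by norm_num)

/-- In the pointwise expansion `norm_cexp_step_le` every main term is an exponential of an earlier
partial sum times a factor independent of it, and that factor is centred: by `mean`, by `cov`, or by
`second_moment`. Only the cubic remainder survives integration. -/
lemma norm_integral_step_le (h : IsOneDependent P X N v K) (hv : 0 ≤ v) (u : ℝ) {k : ℕ}
    (hk : k + 2 < N) :
    ‖(∫ ω, Complex.exp (Complex.I * (u * ∑ i ∈ Finset.range (k + 3), X i ω : ℝ)) ∂P)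
        - (1 - v * u ^ 2 / 2 : ℝ) *
          ∫ ω, Complex.exp (Complex.I * (u * ∑ i ∈ Finset.range (k + 2), X i ω : ℝ)) ∂P‖
      ≤ |u| ^ 3 * (30 * K + v * (1 + K)) := by
  have i0 : k < N := by omega
  have i1 : k + 1 < N := by omega
  have hexp : ∀ ω j, Complex.exp (Complex.I * (u * ∑ i ∈ Finset.range (j + 1), X i ω : ℝ))
      = Complex.exp (Complex.I * (u * ∑ i ∈ Finset.range j, X i ω : ℝ)) *
        Complex.exp (Complex.I * (u * X j ω : ℝ)) := by
    intro ω j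
    rw [← Complex.exp_add, Finset.sum_range_succ]
    push_cast
    ring_nf
  set z : ℕ → Ω → ℂ :=
    fun j ω ↦ Complex.exp (Complex.I * (u * ∑ i ∈ Finset.range j, X i ω : ℝ)) with hz
  have hzint : ∀ j, Integrable (z j) P := fun j ↦ by
    simpa only [Complex.ofReal_one, mul_one] using
      h.integrable_cexp_mul u j (integrable_const (1 : ℝ))
  have hbc : Integrable (fun ω ↦ X (k + 1) ω * X (k + 2) ω) P :=
    (h.memLp_two i1).integrable_mul (h.memLp_two hk)
  have hcc : Integrable (fun ω ↦ X (k + 2) ω ^ 2 - v) P :=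
    (h.memLp_two hk).integrable_sq.sub (integrable_const v)
  have I1 : Integrable (fun ω ↦ Complex.I * u * (z (k + 1) ω * X (k + 2) ω)) P :=
    (h.integrable_cexp_mul u (k + 1) (h.integrable_self hk)).const_mul _
  have I2 : Integrable (fun ω ↦ (u : ℂ) ^ 2 * (z k ω * (X (k + 1) ω * X (k + 2) ω : ℝ))) P :=
    (h.integrable_cexp_mul u k hbc).const_mul _
  have I3 : Integrable (fun ω ↦ (u : ℂ) ^ 2 / 2 * (z (k + 1) ω * (X (k + 2) ω ^ 2 - v : ℝ))) P :=
    (h.integrable_cexp_mul u (k + 1) hcc).const_mul _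
  have I4 : Integrable (fun ω ↦ ((1 - v * u ^ 2 / 2 : ℝ) : ℂ) * z (k + 2) ω) P :=
    (hzint _).const_mul _
  have E1 : ∫ ω, z (k + 1) ω * (X (k + 2) ω : ℂ) ∂P = 0 := by
    have := h.integral_cexp_mul_comp u (k + 1) (f := fun x ↦ x.1) measurable_fst
    simp only [h.mean (k + 1 + 1) hk, Complex.ofReal_zero, mul_zero] at this
    exact this
  have E2 : ∫ ω, z k ω * ((X (k + 1) ω * X (k + 2) ω : ℝ) : ℂ) ∂P = 0 := by
    have := h.integral_cexp_mul_comp u k (f := fun x ↦ x.1 * x.2) (by fun_prop)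
    simp only [h.cov (k + 1) hk, Complex.ofReal_zero, mul_zero] at this
    exact this
  have E3 : ∫ ω, z (k + 1) ω * ((X (k + 2) ω ^ 2 - v : ℝ) : ℂ) ∂P = 0 := by
    have := h.integral_cexp_mul_comp u (k + 1) (f := fun x ↦ x.1 ^ 2 - v) (by fun_prop)
    have e : ∫ ω, (X (k + 1 + 1) ω ^ 2 - v) ∂P = 0 := by
      rw [integral_sub (h.memLp_two hk).integrable_sq (integrable_const v),
        h.second_moment _ hk]
      simp
    simp only [e, Complex.ofReal_zero, mul_zero] at this
    exact this
  have hR : (∫ ω, z (k + 3) ω ∂P) - (1 - v * u ^ 2 / 2 : ℝ) * ∫ ω, z (k + 2) ω ∂P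
      = ∫ ω, (z (k + 3) ω - (1 - v * u ^ 2 / 2 : ℝ) * z (k + 2) ω
        - (Complex.I * u * (z (k + 1) ω * X (k + 2) ω)
          - u ^ 2 * (z k ω * (X (k + 1) ω * X (k + 2) ω : ℝ))
          - u ^ 2 / 2 * (z (k + 1) ω * (X (k + 2) ω ^ 2 - v : ℝ)))) ∂P := by
    rw [integral_sub (by exact (hzint _).sub I4) (by exact (I1.sub I2).sub I3),
      integral_sub (hzint _) I4, integral_sub (by exact I1.sub I2) I3, integral_sub I1 I2]
    simp only [integral_const_mul]
    rw [E1, E2, E3]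
    simp
  rw [hR]
  have s2 : Integrable (fun ω ↦ |X k ω| ^ 3 + |X (k + 1) ω| ^ 3) P :=
    (h.integrable _ i0).add (h.integrable _ i1)
  have s3 : Integrable (fun ω ↦ |X k ω| ^ 3 + |X (k + 1) ω| ^ 3 + |X (k + 2) ω| ^ 3) P :=
    s2.add (h.integrable _ hk)
  have s1 : Integrable (fun ω ↦ 1 + |X (k + 1) ω| ^ 3) P :=
    (integrable_const _).add (h.integrable _ i1)
  have hb : Integrable (fun ω ↦ |u| ^ 3 * (10 * (|X k ω| ^ 3 + |X (k + 1) ω| ^ 3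
      + |X (k + 2) ω| ^ 3) + v * (1 + |X (k + 1) ω| ^ 3))) P :=
    ((s3.const_mul _).add (s1.const_mul _)).const_mul _
  refine (norm_integral_le_of_norm_le hb (ae_of_all _ fun ω ↦ ?_)).trans ?_
  · have := norm_cexp_step_le u v (X k ω) (X (k + 1) ω) (X (k + 2) ω) hv (z k ω)
      (Complex.norm_exp_I_mul_ofReal _)
    simp only [hz, hexp] at this ⊢
    exact this
  · rw [integral_const_mul, integral_add (s3.const_mul _) (s1.const_mul _), integral_const_mul,
      integral_const_mul, integral_add s2 (h.integrable _ hk),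
      integral_add (h.integrable _ i0) (h.integrable _ i1),
      integral_add (integrable_const _) (h.integrable _ i1)]
    have a := h.third_moment _ i0
    have b := h.third_moment _ i1
    have c := h.third_moment _ hk
    have : v * (1 + ∫ ω, |X (k + 1) ω| ^ 3 ∂P) ≤ v * (1 + K) := by gcongr
    refine mul_le_mul_of_nonneg_left ?_ (by positivity)
    simp only [integral_const, probReal_univ, one_smul]
    linarith

lemma norm_integral_cexp_le_one (u : ℝ) (g : Ω → ℝ) :
    ‖∫ ω, Complex.exp (Complex.I * (u * g ω : ℝ)) ∂P‖ ≤ 1 := by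
  refine (norm_integral_le_of_norm_le_const (C := 1) (ae_of_all _ fun ω ↦
    (Complex.norm_exp_I_mul_ofReal _).le)).trans ?_
  simp

/-- The characteristic function of the sum of a one-dependent sequence with uncorrelated terms is
close to that of a Gaussian law. -/
lemma norm_integral_cexp_sub_le (h : IsOneDependent P X N v K) (hv : 0 ≤ v) (u : ℝ) {k : ℕ}
    (hk : k + 2 ≤ N) :
    ‖(∫ ω, Complex.exp (Complex.I * (u * ∑ i ∈ Finset.range (k + 2), X i ω : ℝ)) ∂P)
        - Real.exp (-((k + 2 : ℕ) * (v * u ^ 2 / 2)))‖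
      ≤ 2 * |u| * (1 + K) + v * u ^ 2
        + k * (|u| ^ 3 * (30 * K + v * (1 + K)) + (v * u ^ 2 / 2) ^ 2) := by
  have hx : 0 ≤ v * u ^ 2 / 2 := by positivity
  induction k with
  -- With two terms no cancellation is needed: both quantities are close to `1`, the first by `|exp
  -- (i x) - 1| ≤ |x|` and `|X| ≤ 1 + |X|³`.
  | zero =>
    have i0 : 0 < N := by omega
    have i1 : 1 < N := by omega
    have s0 : Integrable (fun ω ↦ 1 + |X 0 ω| ^ 3) P :=
      (integrable_const _).add (h.integrable _ i0)
    have s1 : Integrable (fun ω ↦ 1 + |X 1 ω| ^ 3) P :=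
      (integrable_const _).add (h.integrable _ i1)
    have hint : Integrable (fun ω ↦ |u| * ((1 + |X 0 ω| ^ 3) + (1 + |X 1 ω| ^ 3))) P :=
      (s0.add s1).const_mul _
    have hzint : Integrable (fun ω ↦
        Complex.exp (Complex.I * (u * ∑ i ∈ Finset.range (0 + 2), X i ω : ℝ))) P := by
      simpa using h.integrable_cexp_mul u (0 + 2) (integrable_const (1 : ℝ))
    have h1 : ‖(∫ ω, Complex.exp (Complex.I * (u * ∑ i ∈ Finset.range (0 + 2), X i ω : ℝ)) ∂P)
        - 1‖ ≤ 2 * |u| * (1 + K) := by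
      have e : (∫ ω, Complex.exp (Complex.I * (u * ∑ i ∈ Finset.range (0 + 2), X i ω : ℝ)) ∂P)
          - 1 = ∫ ω, (Complex.exp
            (Complex.I * (u * ∑ i ∈ Finset.range (0 + 2), X i ω : ℝ)) - 1) ∂P := by
        rw [integral_sub hzint (integrable_const _)]
        simp
      rw [e]
      refine (norm_integral_le_of_norm_le hint (ae_of_all _ fun ω ↦ ?_)).trans ?_
      · refine Real.norm_exp_I_mul_ofReal_sub_one_le.trans ?_
        rw [Real.norm_eq_abs, abs_mul]
        simp only [zero_add, Finset.sum_range_succ, Finset.sum_range_zero]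
        gcongr
        exact (abs_add_le _ _).trans (add_le_add (le_one_add_cube (abs_nonneg _))
          (le_one_add_cube (abs_nonneg _)))
      · rw [integral_const_mul, integral_add s0 s1,
          integral_add (integrable_const _) (h.integrable _ i0),
          integral_add (integrable_const _) (h.integrable _ i1)]
        have a := h.third_moment _ i0
        have b := h.third_moment _ i1
        simp only [integral_const, probReal_univ, one_smul]
        nlinarith [abs_nonneg u]
    have h2 : ‖(1 : ℂ) - Real.exp (-((0 + 2 : ℕ) * (v * u ^ 2 / 2)))‖ ≤ v * u ^ 2 := by
      rw [← Complex.ofReal_one, ← Complex.ofReal_sub, Complex.norm_real, Real.norm_eq_abs,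
        abs_le]
      have := Real.add_one_le_exp (-((0 + 2 : ℕ) * (v * u ^ 2 / 2)))
      have h3 : Real.exp (-((0 + 2 : ℕ) * (v * u ^ 2 / 2))) ≤ 1 :=
        Real.exp_le_one_iff.2 (by push_cast; linarith)
      push_cast at this h3 ⊢
      constructor <;> linarith
    have := norm_sub_le_norm_sub_add_norm_sub (∫ ω, Complex.exp
      (Complex.I * (u * ∑ i ∈ Finset.range (0 + 2), X i ω : ℝ)) ∂P) 1
      (Real.exp (-((0 + 2 : ℕ) * (v * u ^ 2 / 2))) : ℂ)
    push_cast at this h1 h2 ⊢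
    linarith
  | succ k ih =>
    have ih := ih (by omega)
    have hs := h.norm_integral_step_le hv u (k := k) (by omega)
    set φ := ∫ ω, Complex.exp (Complex.I * (u * ∑ i ∈ Finset.range (k + 2), X i ω : ℝ)) ∂P
    have hφ : ‖φ‖ ≤ 1 := norm_integral_cexp_le_one u _
    set x := v * u ^ 2 / 2
    have e : Real.exp (-((k + 1 + 2 : ℕ) * x)) =
        Real.exp (-x) * Real.exp (-((k + 2 : ℕ) * x)) := by
      rw [← Real.exp_add]; push_cast; ring_nf
    have hx1 : ‖((1 - x - Real.exp (-x) : ℝ) : ℂ) * φ‖ ≤ x ^ 2 := by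
      rw [norm_mul, Complex.norm_real, Real.norm_eq_abs]
      calc _ ≤ x ^ 2 * 1 := by
            gcongr
            exact abs_one_sub_sub_exp_neg_le hx
        _ = _ := mul_one _
    have hx2 : ‖(Real.exp (-x) : ℂ) * (φ - Real.exp (-((k + 2 : ℕ) * x)))‖
        ≤ ‖φ - Real.exp (-((k + 2 : ℕ) * x))‖ := by
      rw [norm_mul, Complex.norm_real, Real.norm_eq_abs, abs_of_pos (Real.exp_pos _)]
      exact mul_le_of_le_one_left (norm_nonneg _) (Real.exp_le_one_iff.2 (by linarith))
    -- Three errors: the one-step error, the error of replacing `1 - x` by `exp (-x)`, and the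
    -- previous error, which the factor `exp (-x) ≤ 1` does not enlarge. Errors therefore only add
    -- up.
    have e2 : (∫ ω, Complex.exp (Complex.I * (u * ∑ i ∈ Finset.range (k + 3), X i ω : ℝ)) ∂P)
        - Real.exp (-((k + 1 + 2 : ℕ) * x))
        = ((∫ ω, Complex.exp (Complex.I * (u * ∑ i ∈ Finset.range (k + 3), X i ω : ℝ)) ∂P)
          - (1 - x : ℝ) * φ) + ((1 - x - Real.exp (-x) : ℝ) : ℂ) * φ
          + (Real.exp (-x) : ℂ) * (φ - Real.exp (-((k + 2 : ℕ) * x))) := by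
      rw [e]; push_cast; ring
    have e3 : k + 1 + 2 = k + 3 := by ring
    rw [e3] at e2 ⊢
    rw [e2]
    refine (norm_add_le _ _).trans ((add_le_add ((norm_add_le _ _).trans (add_le_add hs hx1))
      (hx2.trans ih)).trans (le_of_eq ?_))
    push_cast
    ring

end IsOneDependent

end OneDependent

/-! ### Moments of correlated Gaussian pairs. -/

section Moments

variable {Ω : Type*} {mΩ : MeasurableSpace Ω} {P : Measure Ω}

/-- `f` has finite moments of all orders. -/
def HasAllMoments (P : Measure Ω) (f : Ω → ℝ) : Prop :=
  ∀ p : ENNReal, p ≠ ⊤ → MemLp f p P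

namespace HasAllMoments

variable {f g : Ω → ℝ}

lemma integrable (hf : HasAllMoments P f) : Integrable f P :=
  memLp_one_iff_integrable.1 (hf 1 (by simp))

lemma add (hf : HasAllMoments P f) (hg : HasAllMoments P g) :
    HasAllMoments P (fun ω ↦ f ω + g ω) :=
  fun p hp ↦ (hf p hp).add (hg p hp)

lemma mul (hf : HasAllMoments P f) (hg : HasAllMoments P g) :
    HasAllMoments P (fun ω ↦ f ω * g ω) := by
  intro p hp
  have : ENNReal.HolderTriple (2 * p) (2 * p) p := ⟨by
    rw [ENNReal.mul_inv (by simp) (by simp), ← add_mul, ENNReal.inv_two_add_inv_two, one_mul]⟩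
  have h2 : 2 * p ≠ ⊤ := ENNReal.mul_ne_top (by simp) hp
  exact (hg _ h2).mul (hf _ h2)

lemma const [IsFiniteMeasure P] (c : ℝ) : HasAllMoments P (fun _ ↦ c) :=
  fun _ _ ↦ memLp_const c

lemma sub (hf : HasAllMoments P f) (hg : HasAllMoments P g) :
    HasAllMoments P (fun ω ↦ f ω - g ω) :=
  fun p hp ↦ (hf p hp).sub (hg p hp)

lemma pow [IsFiniteMeasure P] (hf : HasAllMoments P f) (n : ℕ) :
    HasAllMoments P (fun ω ↦ f ω ^ n) := by
  induction n with
  | zero => simpa using const 1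
  | succ n ih => simpa only [pow_succ] using ih.mul hf

end HasAllMoments

/-- Each derivative of the moment generating function `exp (t² / 2)` is a polynomial times itself;
this rule updates the polynomial, and four applications give the fourth moment. -/
lemma hasDerivAt_mul_exp_half_sq {p : ℝ → ℝ} {p' x : ℝ} (hp : HasDerivAt p p' x) :
    HasDerivAt (fun t ↦ p t * Real.exp (t ^ 2 / 2)) ((p' + x * p x) * Real.exp (x ^ 2 / 2)) x := by
  have h1 : HasDerivAt (fun t : ℝ ↦ t ^ 2 / 2) x x := by
    simpa using (hasDerivAt_pow 2 x).div_const 2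
  exact (hp.mul h1.exp).congr_deriv (by ring)

lemma integral_pow_four_gaussianReal : ∫ x, x ^ 4 ∂(gaussianReal 0 1) = 3 := by
  have h := iteratedDeriv_mgf_zero (X := id) (μ := gaussianReal 0 1)
    (by rw [integrableExpSet_id_gaussianReal]; simp) 4
  have e0 : mgf id (gaussianReal 0 1) = fun t ↦ 1 * Real.exp (t ^ 2 / 2) := by
    rw [mgf_id_gaussianReal]; funext t; simp
  have e1 : deriv (fun t : ℝ ↦ 1 * Real.exp (t ^ 2 / 2)) = fun t ↦ t * Real.exp (t ^ 2 / 2) := by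
    funext x
    refine (hasDerivAt_mul_exp_half_sq (hasDerivAt_const x (1 : ℝ))).deriv.trans ?_
    ring
  have e2 : deriv (fun t : ℝ ↦ t * Real.exp (t ^ 2 / 2)) =
      fun t ↦ (1 + t ^ 2) * Real.exp (t ^ 2 / 2) := by
    funext x
    refine (hasDerivAt_mul_exp_half_sq (hasDerivAt_id' x)).deriv.trans ?_
    ring
  have e3 : deriv (fun t : ℝ ↦ (1 + t ^ 2) * Real.exp (t ^ 2 / 2)) =
      fun t ↦ (3 * t + t ^ 3) * Real.exp (t ^ 2 / 2) := by
    funext x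
    refine (hasDerivAt_mul_exp_half_sq ((hasDerivAt_pow 2 x).const_add 1)).deriv.trans ?_
    norm_num
    ring_nf
  have e4 : deriv (fun t : ℝ ↦ (3 * t + t ^ 3) * Real.exp (t ^ 2 / 2)) 0 = 3 := by
    refine (hasDerivAt_mul_exp_half_sq
      (((hasDerivAt_id' (0 : ℝ)).const_mul 3).add (hasDerivAt_pow 3 (0 : ℝ)))).deriv.trans ?_
    simp
  rw [e0, iteratedDeriv_succ, iteratedDeriv_succ, iteratedDeriv_succ, iteratedDeriv_one, e1, e2, e3,
    e4] at h
  simpa using h.symm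

lemma hasAllMoments_gaussianReal (m : ℝ) (v : NNReal) : HasAllMoments (gaussianReal m v) id :=
  fun p hp ↦ memLp_id_gaussianReal' p hp

/-- The sixth moment of the standard Gaussian law. -/
noncomputable def sixthMoment : ℝ := ∫ x, x ^ 6 ∂(gaussianReal 0 1)

lemma integral_pow_gaussianReal_zero {h : ℝ} (hh : 0 ≤ h) (n : ℕ) :
    ∫ x, x ^ n ∂(gaussianReal 0 h.toNNReal) = √h ^ n * ∫ x, x ^ n ∂(gaussianReal 0 1) := by
  have e : gaussianReal 0 h.toNNReal = (gaussianReal 0 1).map (√h * ·) := by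
    rw [gaussianReal_map_const_mul]
    congr 1
    · simp
    · ext; simp [Real.sq_sqrt hh, Real.coe_toNNReal _ hh]
  rw [e, integral_map (by fun_prop) (by fun_prop), ← integral_const_mul]
  simp_rw [mul_pow]

lemma integral_sq_gaussianReal_zero {h : ℝ} (hh : 0 ≤ h) :
    ∫ x, x ^ 2 ∂(gaussianReal 0 h.toNNReal) = h := by
  have := variance_id_gaussianReal (μ := 0) (v := h.toNNReal)
  rw [variance_of_integral_eq_zero (by fun_prop) (by simp)] at this
  simpa [Real.coe_toNNReal _ hh] using this

lemma integral_pow_four_gaussianReal_zero {h : ℝ} (hh : 0 ≤ h) :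
    ∫ x, x ^ 4 ∂(gaussianReal 0 h.toNNReal) = 3 * h ^ 2 := by
  rw [integral_pow_gaussianReal_zero hh, integral_pow_four_gaussianReal,
    show √h ^ 4 = (√h ^ 2) ^ 2 by ring, Real.sq_sqrt hh]
  ring

/-- The sixth moment only enters a uniform bound on third absolute moments of products, so scaling
in `h` matters and the numerical constant does not. -/
lemma integral_pow_six_gaussianReal_zero {h : ℝ} (hh : 0 ≤ h) :
    ∫ x, x ^ 6 ∂(gaussianReal 0 h.toNNReal) = sixthMoment * h ^ 3 := by
  rw [integral_pow_gaussianReal_zero hh, sixthMoment,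
    show √h ^ 6 = (√h ^ 2) ^ 3 by ring, Real.sq_sqrt hh]
  ring

lemma sixthMoment_nonneg : 0 ≤ sixthMoment := integral_nonneg fun x ↦ by positivity

/-- The law of the increment over a time span `h` of a Brownian motion with correlation `ρ`. -/
noncomputable def incrementLaw (ρ h : ℝ) : Measure (ℝ × ℝ) :=
  ((gaussianReal 0 h.toNNReal).prod (gaussianReal 0 h.toNNReal)).map
    (fun p : ℝ × ℝ ↦ (p.1, ρ * p.1 + √(1 - ρ ^ 2) * p.2))

/-- The moments of a pair of centred Gaussian variables with variance `h` and correlation `ρ`. -/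
structure IsGaussianPair (P : Measure Ω) (ρ h : ℝ) (p q : Ω → ℝ) : Prop where
  nonneg : 0 ≤ h
  meas_fst : Measurable p
  meas_snd : Measurable q
  moments_fst : HasAllMoments P p
  moments_snd : HasAllMoments P q
  mean_fst : ∫ ω, p ω ∂P = 0
  mean_snd : ∫ ω, q ω ∂P = 0
  sq_fst : ∫ ω, p ω ^ 2 ∂P = h
  sq_snd : ∫ ω, q ω ^ 2 ∂P = h
  six_fst : ∫ ω, p ω ^ 6 ∂P = sixthMoment * h ^ 3
  six_snd : ∫ ω, q ω ^ 6 ∂P = sixthMoment * h ^ 3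
  cov : ∫ ω, p ω * q ω ∂P = ρ * h
  sq_mul_sq : ∫ ω, p ω ^ 2 * q ω ^ 2 ∂P = (1 + 2 * ρ ^ 2) * h ^ 2

lemma IsGaussianPair.symm {ρ h : ℝ} {p q : Ω → ℝ} (H : IsGaussianPair P ρ h p q) :
    IsGaussianPair P ρ h q p where
  nonneg := H.nonneg
  meas_fst := H.meas_snd
  meas_snd := H.meas_fst
  moments_fst := H.moments_snd
  moments_snd := H.moments_fst
  mean_fst := H.mean_snd
  mean_snd := H.mean_fst
  sq_fst := H.sq_snd
  sq_snd := H.sq_fst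
  six_fst := H.six_snd
  six_snd := H.six_fst
  cov := by simpa only [mul_comm] using H.cov
  sq_mul_sq := by rw [← H.sq_mul_sq]; simp only [mul_comm]

/-- The second marginal is a sum of independent Gaussians with variances `ρ² h` and `(1 - ρ²) h`. -/
lemma hasLaw_gaussian_of_hasLaw_incrementLaw {ρ h : ℝ} (hρ : ρ ^ 2 ≤ 1)
    {p q : Ω → ℝ} (H : HasLaw (fun ω ↦ (p ω, q ω)) (incrementLaw ρ h) P) :
    HasLaw p (gaussianReal 0 h.toNNReal) P ∧ HasLaw q (gaussianReal 0 h.toNNReal) P := by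
  set μ := gaussianReal 0 h.toNNReal
  have h1 : HasLaw (fun x : ℝ × ℝ ↦ x.1) μ (μ.prod μ) := 
    ⟨by fun_prop, by simp [Measure.map_fst_prod]⟩
  have h2 : HasLaw (fun x : ℝ × ℝ ↦ x.2) μ (μ.prod μ) := 
    ⟨by fun_prop, by simp [Measure.map_snd_prod]⟩
  have hind : IndepFun (fun x : ℝ × ℝ ↦ ρ * x.1) (fun x ↦ √(1 - ρ ^ 2) * x.2) (μ.prod μ) :=
    indepFun_prod (X := fun x ↦ ρ * x) (Y := fun x ↦ √(1 - ρ ^ 2) * x) (by fun_prop) (by fun_prop)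
  have h3 := gaussianReal_add_gaussianReal_of_indepFun hind
    (gaussianReal_const_mul h1 ρ).map_eq (gaussianReal_const_mul h2 (√(1 - ρ ^ 2))).map_eq
  have hT : HasLaw (fun x : ℝ × ℝ ↦ (x.1, ρ * x.1 + √(1 - ρ ^ 2) * x.2)) (incrementLaw ρ h)
    (μ.prod μ) := ⟨by fun_prop, rfl⟩
  have f1 : HasLaw Prod.fst μ (incrementLaw ρ h) := ⟨by fun_prop, by
    rw [incrementLaw, Measure.map_map (by fun_prop) (by fun_prop)]; exact h1.map_eq⟩
  have f2 : HasLaw Prod.snd μ (incrementLaw ρ h) := ⟨by fun_prop, by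
    rw [incrementLaw, Measure.map_map (by fun_prop) (by fun_prop)]
    refine Eq.trans ?_ (h3.trans ?_)
    · rfl
    · simp only [mul_zero, add_zero, μ]
      congr 1
      ext
      simp only [NNReal.coe_add, NNReal.coe_mul, NNReal.coe_mk, Real.sq_sqrt (sub_nonneg.2 hρ)]
      ring⟩
  exact ⟨f1.comp H, f2.comp H⟩

lemma HasAllMoments.of_hasLaw {f : Ω → ℝ} {h : ℝ}
    (H : HasLaw f (gaussianReal 0 h.toNNReal) P) : HasAllMoments P f := by
  intro p hp
  have := memLp_id_gaussianReal' (μ := 0) (v := h.toNNReal) p hp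
  rw [← H.map_eq, memLp_map_measure_iff (by fun_prop) H.aemeasurable] at this
  simpa using this

lemma integral_pow_of_hasLaw {f : Ω → ℝ} {h : ℝ}
    (H : HasLaw f (gaussianReal 0 h.toNNReal) P) (n : ℕ) :
    ∫ ω, f ω ^ n ∂P = ∫ x, x ^ n ∂(gaussianReal 0 h.toNNReal) :=
  H.integral_comp (f := fun x ↦ x ^ n) (by fun_prop)

lemma isGaussianPair_of_hasLaw {ρ h : ℝ} (hρ : ρ ^ 2 ≤ 1) (hh : 0 ≤ h)
    {p q : Ω → ℝ} (mp : Measurable p) (mq : Measurable q)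
    (H : HasLaw (fun ω ↦ (p ω, q ω)) (incrementLaw ρ h) P) : IsGaussianPair P ρ h p q := by
  obtain ⟨Hp, Hq⟩ := hasLaw_gaussian_of_hasLaw_incrementLaw hρ H
  set μ := gaussianReal 0 h.toNNReal with hμ
  have hm : HasAllMoments μ (fun x ↦ x) := hasAllMoments_gaussianReal _ _
  have key : ∀ f : ℝ × ℝ → ℝ, Measurable f → ∫ ω, f (p ω, q ω) ∂P =
      ∫ x, f (x.1, ρ * x.1 + √(1 - ρ ^ 2) * x.2) ∂(μ.prod μ) := by
    intro f hf
    refine (H.integral_comp (f := f) hf.aestronglyMeasurable).trans ?_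
    rw [incrementLaw, integral_map (by fun_prop) (by fun_prop)]
  have hs := Real.sq_sqrt (sub_nonneg.2 hρ)
  have prodI : ∀ m n : ℕ, Integrable (fun x : ℝ × ℝ ↦ x.1 ^ m * x.2 ^ n) (μ.prod μ) := fun m n ↦
    Integrable.mul_prod (f := fun x ↦ x ^ m) (g := fun x ↦ x ^ n) (hm.pow m).integrable
      (hm.pow n).integrable
  have prodE : ∀ m n : ℕ, ∫ x : ℝ × ℝ, x.1 ^ m * x.2 ^ n ∂(μ.prod μ) =
      (∫ x, x ^ m ∂μ) * ∫ x, x ^ n ∂μ := fun m n ↦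
    integral_prod_mul (fun x ↦ x ^ m) (fun x ↦ x ^ n)
  have m1 : ∫ x, x ^ 1 ∂μ = 0 := by simp [hμ]
  have m0 : ∫ x, x ^ 0 ∂μ = 1 := by simp
  refine ⟨hh, mp, mq, .of_hasLaw Hp, .of_hasLaw Hq, ?_, ?_, ?_, ?_, ?_, ?_, ?_, ?_⟩
  · simpa [m1] using integral_pow_of_hasLaw Hp 1
  · simpa [m1] using integral_pow_of_hasLaw Hq 1
  · rw [integral_pow_of_hasLaw Hp, integral_sq_gaussianReal_zero hh]
  · rw [integral_pow_of_hasLaw Hq, integral_sq_gaussianReal_zero hh]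
  · rw [integral_pow_of_hasLaw Hp, integral_pow_six_gaussianReal_zero hh]
  · rw [integral_pow_of_hasLaw Hq, integral_pow_six_gaussianReal_zero hh]
  · rw [key (fun x ↦ x.1 * x.2) (by fun_prop)]
    calc _ = ∫ x : ℝ × ℝ, (ρ * (x.1 ^ 2 * x.2 ^ 0) + √(1 - ρ ^ 2) * (x.1 ^ 1 * x.2 ^ 1))
          ∂(μ.prod μ) := by congr 1; funext x; ring
      _ = ρ * h := by
        rw [integral_add ((prodI _ _).const_mul _) ((prodI _ _).const_mul _), integral_const_mul,
          integral_const_mul, prodE, prodE, m0, m1, integral_sq_gaussianReal_zero hh]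
        ring
  · rw [key (fun x ↦ x.1 ^ 2 * x.2 ^ 2) (by fun_prop)]
    have I1 := (prodI 4 0).const_mul (ρ ^ 2)
    have I2 := (prodI 3 1).const_mul (2 * ρ * √(1 - ρ ^ 2))
    have I3 := (prodI 2 2).const_mul (√(1 - ρ ^ 2) ^ 2)
    -- The term with odd powers integrates to zero; the others give `3 ρ² + (1 - ρ²) = 1 + 2 ρ²`.
    calc _ = ∫ x : ℝ × ℝ, (ρ ^ 2 * (x.1 ^ 4 * x.2 ^ 0)
            + 2 * ρ * √(1 - ρ ^ 2) * (x.1 ^ 3 * x.2 ^ 1)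
            + √(1 - ρ ^ 2) ^ 2 * (x.1 ^ 2 * x.2 ^ 2)) ∂(μ.prod μ) := by
          congr 1; funext x; ring
      _ = (1 + 2 * ρ ^ 2) * h ^ 2 := by
        rw [integral_add (by exact I1.add I2) I3, integral_add I1 I2, integral_const_mul,
          integral_const_mul, integral_const_mul, prodE, prodE, prodE, m0, m1,
          integral_sq_gaussianReal_zero hh, integral_pow_four_gaussianReal_zero hh, hs]
        ring

end Moments

/-! ### Independent Gaussian cells and the products of overlapping increments. -/

section Array

variable {Ω : Type*} {mΩ : MeasurableSpace Ω} {P : Measure Ω}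

/-- Increments of a correlated Brownian motion over successive intervals are independent. -/
lemma IsCorrelatedBrownian.iIndepFun_increments [IsProbabilityMeasure P] {𝓕 : Filtration ℝ mΩ}
    {S : Set ℝ} {ρ : ℝ} {B₁ B₂ : ℝ → Ω → ℝ} (hB : IsCorrelatedBrownian P 𝓕 S ρ B₁ B₂)
    {t : ℕ → ℝ} (ht : Monotone t) (htS : ∀ j, t j ∈ S) :
    iIndepFun (fun j ω ↦ (B₁ (t (j + 1)) ω - B₁ (t j) ω, B₂ (t (j + 1)) ω - B₂ (t j) ω)) P := by
  rw [iIndepFun_iff_measure_inter_preimage_eq_mul]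
  intro s
  -- Peeling off the largest index `a` works because all earlier increments are measurable with
  -- respect to `𝓕 (t a)`, of which the increment starting at `t a` is independent.
  induction s using Finset.induction_on_max with
  | empty => intro sets _; simp
  | insert a s ha ih =>
    intro sets hsets
    have has : a ∉ s := fun h ↦ lt_irrefl _ (ha a h)
    rw [Finset.set_biInter_insert, Finset.prod_insert has,
      ← ih fun i hi ↦ hsets i (Finset.mem_insert_of_mem hi)]
    have hind := hB.indep (t a) (htS a) (t (a + 1)) (htS _) (ht a.le_succ)
    refine (Indep_iff _ _ _).1 hind _ _ ⟨sets a, hsets a (Finset.mem_insert_self _ _), rfl⟩ ?_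
    refine MeasurableSet.biInter s.countable_toSet fun i hi ↦ ?_
    have hadapt := hB.adapted (t i) (htS i) (t (i + 1)) (htS _) (ht i.le_succ)
    exact 𝓕.mono (ht (ha i hi)) _ (hadapt (hsets i (Finset.mem_insert_of_mem hi)))

lemma IsCorrelatedBrownian.measurable_increment {𝓕 : Filtration ℝ mΩ}
    {S : Set ℝ} {ρ : ℝ} {B₁ B₂ : ℝ → Ω → ℝ} (hB : IsCorrelatedBrownian P 𝓕 S ρ B₁ B₂)
    {s t : ℝ} (hs : s ∈ S) (ht : t ∈ S) (hst : s ≤ t) :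
    Measurable (fun ω ↦ B₁ t ω - B₁ s ω) ∧ Measurable (fun ω ↦ B₂ t ω - B₂ s ω) := by
  have h := (hB.adapted s hs t ht hst).mono (𝓕.le t) le_rfl
  exact ⟨measurable_fst.comp h, measurable_snd.comp h⟩

lemma IsCorrelatedBrownian.isGaussianPair {𝓕 : Filtration ℝ mΩ}
    {S : Set ℝ} {ρ : ℝ} {B₁ B₂ : ℝ → Ω → ℝ} (hB : IsCorrelatedBrownian P 𝓕 S ρ B₁ B₂)
    (hρ : ρ ^ 2 ≤ 1) {s t : ℝ} (hs : s ∈ S) (ht : t ∈ S) (hst : s ≤ t) :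
    IsGaussianPair P ρ (t - s) (fun ω ↦ B₁ t ω - B₁ s ω) (fun ω ↦ B₂ t ω - B₂ s ω) :=
  isGaussianPair_of_hasLaw hρ (sub_nonneg.2 hst) (hB.measurable_increment hs ht hst).1
    (hB.measurable_increment hs ht hst).2 (hB.hasLaw s hs t ht hst)

/-- The sigma-algebra generated by the pairs `(p j, q j)`, `j ∈ J`. -/
@[reducible] def pairSigma (p q : ℕ → Ω → ℝ) (J : Set ℕ) : MeasurableSpace Ω :=
  ⨆ j ∈ J, MeasurableSpace.comap (fun ω ↦ (p j ω, q j ω)) inferInstance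

/-- A sequence of independent Gaussian pairs with variances `h j` and correlation `ρ`. -/
structure IsGaussianArray (P : Measure Ω) (ρ : ℝ) (h : ℕ → ℝ) (p q : ℕ → Ω → ℝ) : Prop where
  indep : iIndepFun (fun j ω ↦ (p j ω, q j ω)) P
  pair : ∀ j, IsGaussianPair P ρ (h j) (p j) (q j)

lemma IsGaussianArray.symm {ρ : ℝ} {h : ℕ → ℝ} {p q : ℕ → Ω → ℝ}
    (H : IsGaussianArray P ρ h p q) : IsGaussianArray P ρ h q p where
  indep := H.indep.comp (fun _ ↦ Prod.swap) (fun _ ↦ measurable_swap)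
  pair j := (H.pair j).symm

/-- The centred product of the overlapping increments `p (2i) + p (2i+1)` and
`q (2i+1) + q (2i+2)`. -/
def overlapTerm (ρ : ℝ) (h : ℕ → ℝ) (p q : ℕ → Ω → ℝ) (i : ℕ) (ω : Ω) : ℝ :=
  (p (2 * i) ω + p (2 * i + 1) ω) * (q (2 * i + 1) ω + q (2 * i + 2) ω) - ρ * h (2 * i + 1)

namespace IsGaussianArray

variable {ρ : ℝ} {h : ℕ → ℝ} {p q : ℕ → Ω → ℝ}

omit mΩ in
lemma measurable_pairSigma (p q : ℕ → Ω → ℝ) {J : Set ℕ} {j : ℕ} (hj : j ∈ J) :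
    Measurable[pairSigma p q J] (p j) ∧ Measurable[pairSigma p q J] (q j) := by
  have : Measurable[pairSigma p q J] (fun ω ↦ (p j ω, q j ω)) :=
    (comap_measurable _).mono (le_iSup₂ (f := fun j (_ : j ∈ J) ↦
      MeasurableSpace.comap (fun ω ↦ (p j ω, q j ω)) inferInstance) j hj) le_rfl
  exact ⟨measurable_fst.comp this, measurable_snd.comp this⟩

omit mΩ in
lemma measurable_overlapTerm (ρ : ℝ) (h : ℕ → ℝ) (p q : ℕ → Ω → ℝ) {J : Set ℕ} {i : ℕ}
    (h0 : 2 * i ∈ J) (h1 : 2 * i + 1 ∈ J) (h2 : 2 * i + 2 ∈ J) :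
    Measurable[pairSigma p q J] (overlapTerm ρ h p q i) :=
  ((((measurable_pairSigma p q h0).1.add (measurable_pairSigma p q h1).1).mul
    ((measurable_pairSigma p q h1).2.add (measurable_pairSigma p q h2).2)).sub_const _)

variable (H : IsGaussianArray P ρ h p q)
include H

lemma pairSigma_le (J : Set ℕ) : pairSigma p q J ≤ mΩ :=
  iSup₂_le fun j _ ↦ ((H.pair j).meas_fst.prodMk (H.pair j).meas_snd).comap_le

lemma indepFun {β γ : Type*} [mβ : MeasurableSpace β] [mγ : MeasurableSpace γ] {J J' : Set ℕ}
    (hJ : Disjoint J J') {f : Ω → β} {g : Ω → γ} (hf : Measurable[pairSigma p q J] f)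
    (hg : Measurable[pairSigma p q J'] g) : IndepFun f g P := by
  have hi : Indep (pairSigma p q J) (pairSigma p q J') P :=
    indep_iSup_of_disjoint (fun j ↦ ((H.pair j).meas_fst.prodMk (H.pair j).meas_snd).comap_le)
      H.indep.iIndep hJ
  exact indep_of_indep_of_le_left (indep_of_indep_of_le_right hi hg.comap_le) hf.comap_le

lemma integral_mul {J J' : Set ℕ} (hJ : Disjoint J J') {f g : Ω → ℝ}
    (hf : Measurable[pairSigma p q J] f) (hg : Measurable[pairSigma p q J'] g) :
    ∫ ω, f ω * g ω ∂P = (∫ ω, f ω ∂P) * ∫ ω, g ω ∂P :=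
  (H.indepFun hJ hf hg).integral_fun_mul_eq_mul_integral
    (hf.mono (H.pairSigma_le J) le_rfl).aestronglyMeasurable
    (hg.mono (H.pairSigma_le J') le_rfl).aestronglyMeasurable

/-- The cross term vanishes because `Z` is centred and independent of `F` and `W`. This removes from
a square the cell that the other factor does not see. -/
lemma integral_mul_add_sq {J J' : Set ℕ} (hJ : Disjoint J J') {F W Z : Ω → ℝ}
    (hF : Measurable[pairSigma p q J] F) (hW : Measurable[pairSigma p q J] W)
    (hZ : Measurable[pairSigma p q J'] Z) (mF : HasAllMoments P F) (mW : HasAllMoments P W)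
    (mZ : HasAllMoments P Z) {v : ℝ} (hZ0 : ∫ ω, Z ω ∂P = 0) (hZ2 : ∫ ω, Z ω ^ 2 ∂P = v) :
    ∫ ω, F ω * (Z ω + W ω) ^ 2 ∂P = v * (∫ ω, F ω ∂P) + ∫ ω, F ω * W ω ^ 2 ∂P := by
  have I1 : Integrable (fun ω ↦ F ω * Z ω ^ 2) P := by
    simpa only [pow_two] using (mF.mul (mZ.mul mZ)).integrable
  have I2 : Integrable (fun ω ↦ 2 * (F ω * W ω * Z ω)) P :=
    ((mF.mul mW).mul mZ).integrable.const_mul _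
  have I3 : Integrable (fun ω ↦ F ω * W ω ^ 2) P := by
    simpa only [pow_two] using (mF.mul (mW.mul mW)).integrable
  have e1 : ∫ ω, F ω * Z ω ^ 2 ∂P = (∫ ω, F ω ∂P) * ∫ ω, Z ω ^ 2 ∂P :=
    H.integral_mul hJ hF (hZ.pow_const 2)
  have e2 : ∫ ω, F ω * W ω * Z ω ∂P = (∫ ω, F ω * W ω ∂P) * ∫ ω, Z ω ∂P :=
    H.integral_mul hJ (hF.mul hW) hZ
  calc _ = ∫ ω, (F ω * Z ω ^ 2 + 2 * (F ω * W ω * Z ω) + F ω * W ω ^ 2) ∂P := by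
        congr 1; funext ω; ring
    _ = _ := by
        rw [integral_add (by exact I1.add I2) I3, integral_add I1 I2, integral_const_mul, e1, e2,
          hZ0, hZ2]
        ring

lemma moments_overlapTerm (i : ℕ) : HasAllMoments P (overlapTerm ρ h p q i) := by
  have := H.indep.isProbabilityMeasure
  exact (((H.pair _).moments_fst.add (H.pair _).moments_fst).mul
    ((H.pair _).moments_snd.add (H.pair _).moments_snd)).sub (.const _)

lemma integral_overlapTerm (i : ℕ) : ∫ ω, overlapTerm ρ h p q i ω ∂P = 0 := by
  have := H.indep.isProbabilityMeasure
  have a0 := H.pair (2 * i)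
  have a1 := H.pair (2 * i + 1)
  have a2 := H.pair (2 * i + 2)
  have s := fun j ↦ measurable_pairSigma p q (Set.mem_singleton j)
  have i1 := (a0.moments_fst.mul a1.moments_snd).integrable
  have i2 := (a0.moments_fst.mul a2.moments_snd).integrable
  have i3 := (a1.moments_fst.mul a1.moments_snd).integrable
  have i4 := (a1.moments_fst.mul a2.moments_snd).integrable
  have e1 := H.integral_mul (by simp) (s (2 * i)).1 (s (2 * i + 1)).2
  have e2 := H.integral_mul (by simp) (s (2 * i)).1 (s (2 * i + 2)).2
  have e4 := H.integral_mul (by simp) (s (2 * i + 1)).1 (s (2 * i + 2)).2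
  calc _ = ∫ ω, (p (2 * i) ω * q (2 * i + 1) ω + p (2 * i) ω * q (2 * i + 2) ω
          + p (2 * i + 1) ω * q (2 * i + 1) ω + p (2 * i + 1) ω * q (2 * i + 2) ω
          - ρ * h (2 * i + 1)) ∂P := by
        congr 1; funext ω; simp only [overlapTerm]; ring
    _ = 0 := by
        rw [integral_sub (by exact ((i1.add i2).add i3).add i4) (integrable_const _),
          integral_add (by exact (i1.add i2).add i3) i4, integral_add (by exact i1.add i2) i3,
          integral_add i1 i2, e1, e2, e4, a1.cov, a0.mean_fst, a1.mean_fst]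
        simp

/-- Only the middle cell correlates the two factors: the uncentred second moment is the product of
the variances plus `2 ρ² h²`, with `h` the length of that cell, and centring removes one `ρ² h²`. -/
lemma integral_overlapTerm_sq (i : ℕ) : ∫ ω, overlapTerm ρ h p q i ω ^ 2 ∂P =
    (h (2 * i) + h (2 * i + 1)) * (h (2 * i + 1) + h (2 * i + 2)) + ρ ^ 2 * h (2 * i + 1) ^ 2 := by
  have := H.indep.isProbabilityMeasure
  have a0 := H.pair (2 * i)
  have a1 := H.pair (2 * i + 1)
  have a2 := H.pair (2 * i + 2)
  have s := fun j ↦ measurable_pairSigma p q (Set.mem_singleton j)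
  have s0 := measurable_pairSigma p q (J := {2 * i, 2 * i + 1}) (j := 2 * i) (by simp)
  have s1 := measurable_pairSigma p q (J := {2 * i, 2 * i + 1}) (j := 2 * i + 1) (by simp)
  have ma := a0.moments_fst.add a1.moments_fst
  have mb := a2.moments_snd.add a1.moments_snd
  have E1 := H.integral_mul_add_sq (J := {2 * i, 2 * i + 1}) (J' := {2 * i + 2}) (by simp)
    ((s0.1.add s1.1).pow_const 2) s1.2 (s (2 * i + 2)).2 (ma.pow 2) a1.moments_snd a2.moments_snd
    a2.mean_snd a2.sq_snd
  have E2 := H.integral_mul_add_sq (J := {2 * i + 1}) (J' := {2 * i}) (by simp)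
    (measurable_const (a := (1 : ℝ))) (s (2 * i + 1)).1 (s (2 * i)).1 (.const _) a1.moments_fst
    a0.moments_fst a0.mean_fst a0.sq_fst
  have E3 := H.integral_mul_add_sq (J := {2 * i + 1}) (J' := {2 * i}) (by simp)
    ((s (2 * i + 1)).2.pow_const 2) (s (2 * i + 1)).1 (s (2 * i)).1 (a1.moments_snd.pow 2)
    a1.moments_fst a0.moments_fst a0.mean_fst a0.sq_fst
  have E4 : ∫ ω, q (2 * i + 1) ω ^ 2 * p (2 * i + 1) ω ^ 2 ∂P
      = (1 + 2 * ρ ^ 2) * h (2 * i + 1) ^ 2 := a1.symm.sq_mul_sq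
  have E5 : ∫ ω, (p (2 * i) ω + p (2 * i + 1) ω) ^ 2 * q (2 * i + 1) ω ^ 2 ∂P
      = ∫ ω, q (2 * i + 1) ω ^ 2 * (p (2 * i) ω + p (2 * i + 1) ω) ^ 2 ∂P := by
    simp only [mul_comm]
  simp only [Pi.add_apply] at E1
  simp only [one_mul, integral_const, probReal_univ, one_smul, mul_one] at E2
  have E0 := H.integral_overlapTerm i
  have m := H.moments_overlapTerm i
  set c := ρ * h (2 * i + 1) with hc
  calc _ = ∫ ω, ((p (2 * i) ω + p (2 * i + 1) ω) ^ 2 * (q (2 * i + 2) ω + q (2 * i + 1) ω) ^ 2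
          - 2 * c * overlapTerm ρ h p q i ω - c ^ 2) ∂P := by
        congr 1; funext ω; simp only [overlapTerm, ← hc]; ring
    _ = _ := by
        rw [integral_sub (by exact
            ((ma.pow 2).mul (mb.pow 2)).integrable.sub (m.integrable.const_mul _)) (integrable_const _),
          integral_sub ((ma.pow 2).mul (mb.pow 2)).integrable (m.integrable.const_mul _),
          integral_const_mul, E0, E1, E2, E5, E3, a1.sq_fst, a1.sq_snd, E4]
        simp only [integral_const, probReal_univ, one_smul, hc]
        ring

/-- The next term splits into three summands, each with a centred factor that lives on a cell beyond
those of term `i` and is independent of everything it multiplies. The shared cell `2 i + 2` thus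
creates dependence but no correlation. -/
lemma integral_overlapTerm_mul_succ (i : ℕ) :
    ∫ ω, overlapTerm ρ h p q i ω * overlapTerm ρ h p q (i + 1) ω ∂P = 0 := by
  have := H.indep.isProbabilityMeasure
  have a2 := H.pair (2 * i + 2)
  have a3 := H.pair (2 * i + 3)
  have a4 := H.pair (2 * i + 4)
  have mA := H.moments_overlapTerm i
  set A := overlapTerm ρ h p q i with hA
  have sA : Measurable[pairSigma p q (Set.Iio (2 * i + 3))] A :=
    measurable_overlapTerm ρ h p q (Set.mem_Iio.2 (by omega)) (Set.mem_Iio.2 (by omega))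
      (Set.mem_Iio.2 (by omega))
  have sA' : Measurable[pairSigma p q (Set.Iio (2 * i + 4))] A :=
    measurable_overlapTerm ρ h p q (Set.mem_Iio.2 (by omega)) (Set.mem_Iio.2 (by omega))
      (Set.mem_Iio.2 (by omega))
  have s := fun j ↦ measurable_pairSigma p q (Set.mem_singleton j)
  have e1 := H.integral_mul (J' := {2 * i + 3}) (by simp)
    (sA.mul (measurable_pairSigma p q (j := 2 * i + 2) (by simp)).1) (s (2 * i + 3)).2
  have e2 := H.integral_mul (J' := {2 * i + 3}) (by simp) sA
    (((s (2 * i + 3)).1.mul (s (2 * i + 3)).2).sub_const (ρ * h (2 * i + 3)))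
  have e3 := H.integral_mul (J' := {2 * i + 4}) (by simp)
    (sA'.mul ((measurable_pairSigma p q (j := 2 * i + 2) (by simp)).1.add
      (measurable_pairSigma p q (j := 2 * i + 3) (by simp)).1)) (s (2 * i + 4)).2
  have E0 : ∫ ω, A ω ∂P = 0 := H.integral_overlapTerm i
  have i1 := ((mA.mul a2.moments_fst).mul a3.moments_snd).integrable
  have i2 := (mA.mul ((a3.moments_fst.mul a3.moments_snd).sub
    (.const (ρ * h (2 * i + 3))))).integrable
  have i3 := ((mA.mul (a2.moments_fst.add a3.moments_fst)).mul a4.moments_snd).integrable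
  simp only [Pi.mul_apply, Pi.add_apply] at e1 e2 e3
  calc _ = ∫ ω, (A ω * p (2 * i + 2) ω * q (2 * i + 3) ω
          + A ω * (p (2 * i + 3) ω * q (2 * i + 3) ω - ρ * h (2 * i + 3))
          + A ω * (p (2 * i + 2) ω + p (2 * i + 3) ω) * q (2 * i + 4) ω) ∂P := by
        congr 1; funext ω
        simp only [overlapTerm, show 2 * (i + 1) = 2 * i + 2 by ring,
          show 2 * i + 2 + 1 = 2 * i + 3 by ring, show 2 * i + 2 + 2 = 2 * i + 4 by ring]
        ring
    _ = 0 := by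
        rw [integral_add (by exact i1.add i2) i3, integral_add i1 i2, e1, e2, e3, E0, a3.mean_snd,
          a4.mean_snd]
        simp

/-- By convexity and `|x y|³ ≤ (x⁶ + y⁶) / 2` the cube is bounded by sixth powers of four cell
increments, each with coefficient `4 · 32 / 2 = 64`. -/
lemma integral_abs_overlapTerm_le (hρ : ρ ^ 2 ≤ 1) (i : ℕ) {b : ℝ} (hb : ∀ j, h j ≤ b) :
    ∫ ω, |overlapTerm ρ h p q i ω| ^ 3 ∂P ≤ (256 * sixthMoment + 4) * b ^ 3 := by
  have := H.indep.isProbabilityMeasure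
  have a0 := H.pair (2 * i)
  have a1 := H.pair (2 * i + 1)
  have a2 := H.pair (2 * i + 2)
  have hb3 : ∀ j, h j ^ 3 ≤ b ^ 3 := fun j ↦ pow_le_pow_left₀ (H.pair j).nonneg (hb j) 3
  have i1 := (a0.moments_fst.pow 6).integrable
  have i2 := (a1.moments_fst.pow 6).integrable
  have i3 := (a1.moments_snd.pow 6).integrable
  have i4 := (a2.moments_snd.pow 6).integrable
  have hint : Integrable (fun ω ↦ 64 * (p (2 * i) ω ^ 6 + p (2 * i + 1) ω ^ 6
      + q (2 * i + 1) ω ^ 6 + q (2 * i + 2) ω ^ 6) + 4 * b ^ 3) P :=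
    ((((i1.add i2).add i3).add i4).const_mul _).add (integrable_const _)
  calc _ ≤ ∫ ω, (64 * (p (2 * i) ω ^ 6 + p (2 * i + 1) ω ^ 6
      + q (2 * i + 1) ω ^ 6 + q (2 * i + 2) ω ^ 6) + 4 * b ^ 3) ∂P := by
        refine integral_mono_of_nonneg (ae_of_all _ fun ω ↦ by positivity) hint
          (ae_of_all _ fun ω ↦ ?_)
        have k1 := (show Even 6 by decide).add_pow_le (a := p (2 * i) ω) (b := p (2 * i + 1) ω)
        have k2 := (show Even 6 by decide).add_pow_le
          (a := q (2 * i + 1) ω) (b := q (2 * i + 2) ω)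
        simp only [overlapTerm]
        set x := p (2 * i) ω + p (2 * i + 1) ω
        set y := q (2 * i + 1) ω + q (2 * i + 2) ω
        have hc : |ρ * h (2 * i + 1)| ≤ b := by
          rw [abs_mul, abs_of_nonneg a1.nonneg]
          exact (mul_le_of_le_one_left a1.nonneg ((sq_le_one_iff_abs_le_one _).1 hρ)).trans (hb _)
        have hc3 := pow_le_pow_left₀ (abs_nonneg _) hc 3
        have k3 : |x * y - ρ * h (2 * i + 1)| ^ 3 ≤ (|x * y| + |ρ * h (2 * i + 1)|) ^ 3 :=
          pow_le_pow_left₀ (abs_nonneg _) (abs_sub _ _) 3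
        have k4 : (|x * y| + |ρ * h (2 * i + 1)|) ^ 3 ≤ 4 * (|x * y| ^ 3 + |ρ * h (2 * i + 1)| ^ 3) :=
          (add_pow_le (abs_nonneg _) (abs_nonneg _) 3).trans_eq (by norm_num)
        have k5 : |x * y| ^ 3 ≤ (x ^ 6 + y ^ 6) / 2 := by
          have hx : x ^ 6 = (|x| ^ 3) ^ 2 := by
            rw [← pow_mul]; exact ((by decide : Even 6).pow_abs x).symm
          have hy : y ^ 6 = (|y| ^ 3) ^ 2 := by
            rw [← pow_mul]; exact ((by decide : Even 6).pow_abs y).symm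
          rw [abs_mul, mul_pow, hx, hy]
          linarith [two_mul_le_add_sq (|x| ^ 3) (|y| ^ 3)]
        norm_num at k1 k2
        linarith
    _ ≤ _ := by
        rw [integral_add (by exact (((i1.add i2).add i3).add i4).const_mul _) (integrable_const _),
          integral_const_mul, integral_add (by exact (i1.add i2).add i3) i4,
          integral_add (by exact i1.add i2) i3, integral_add i1 i2, a0.six_fst, a1.six_fst,
          a1.six_snd, a2.six_snd]
        simp only [integral_const, probReal_univ, one_smul]
        have M := sixthMoment_nonneg
        have c0 := mul_le_mul_of_nonneg_left (hb3 (2 * i)) M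
        have c1 := mul_le_mul_of_nonneg_left (hb3 (2 * i + 1)) M
        have c2 := mul_le_mul_of_nonneg_left (hb3 (2 * i + 2)) M
        linarith

/-- The scaling `s = 1 / b` makes the third-moment bound independent of the mesh, as the central
limit theorem needs. -/
lemma isOneDependent (hρ : ρ ^ 2 ≤ 1) {b : ℝ} (hb : ∀ j, h j ≤ b) {s : ℝ} (hs : 0 ≤ s)
    (hsb : s * b = 1) {N : ℕ} {v : ℝ}
    (hv : ∀ i < N, s ^ 2 * ((h (2 * i) + h (2 * i + 1)) * (h (2 * i + 1) + h (2 * i + 2))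
      + ρ ^ 2 * h (2 * i + 1) ^ 2) = v) :
    IsOneDependent P (fun i ω ↦ s * overlapTerm ρ h p q i ω) N v (256 * sixthMoment + 4) where
  measurable i := by
    have := (measurable_overlapTerm ρ h p q (J := Set.univ) (i := i) trivial trivial trivial).mono
      (H.pairSigma_le _) le_rfl
    exact this.const_mul s
  integrable i _ := by
    have := H.indep.isProbabilityMeasure
    have := ((((HasAllMoments.const s).mul (H.moments_overlapTerm i)).pow 3).integrable).abs
    simpa only [abs_pow] using this
  third_moment i _ := by
    simp only [abs_mul, mul_pow, abs_of_nonneg hs]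
    rw [integral_const_mul]
    calc _ ≤ s ^ 3 * ((256 * sixthMoment + 4) * b ^ 3) :=
          mul_le_mul_of_nonneg_left (H.integral_abs_overlapTerm_le hρ i hb) (by positivity)
      _ = (256 * sixthMoment + 4) * (s * b) ^ 3 := by ring
      _ = _ := by rw [hsb]; ring
  mean i _ := by rw [integral_const_mul, H.integral_overlapTerm, mul_zero]
  second_moment i hi := by
    simp only [mul_pow]
    rw [integral_const_mul, H.integral_overlapTerm_sq, hv i hi]
  cov i _ := by
    rw [← mul_zero (s ^ 2), ← H.integral_overlapTerm_mul_succ i, ← integral_const_mul]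
    congr 1; funext ω; ring
  indep k := by
    -- The terms before `k` use cells up to `2 k`, those after `k` use cells from `2 k + 2` on.
    have hd : Disjoint (Set.Iio (2 * k + 1)) (Set.Ici (2 * k + 1)) :=
      Set.disjoint_left.2 fun x hx hx' ↦ by simp at hx hx'; omega
    refine H.indepFun hd (Finset.measurable_fun_sum _ fun i hi ↦ ?_) ?_
    · have := Finset.mem_range.1 hi
      exact (measurable_overlapTerm ρ h p q (Set.mem_Iio.2 (by omega)) (Set.mem_Iio.2 (by omega))
        (Set.mem_Iio.2 (by omega))).const_mul s
    · exact ((measurable_overlapTerm ρ h p q (Set.mem_Ici.2 (by omega)) (Set.mem_Ici.2 (by omega))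
        (Set.mem_Ici.2 (by omega))).const_mul s).prodMk
        ((measurable_overlapTerm ρ h p q (Set.mem_Ici.2 (by omega))
        (Set.mem_Ici.2 (by omega)) (Set.mem_Ici.2 (by omega))).const_mul s)

end IsGaussianArray

end Array

/-! ### The merged grid. -/

section Grid

/-- The points `c + i Δ` and `c + i Δ + τ` in alternation, stopped at `c + N Δ + τ`. -/
noncomputable def gridPoint (c Δ τ : ℝ) (N j : ℕ) : ℝ :=
  min (c + (j / 2 : ℕ) * Δ + (j % 2 : ℕ) * τ) (c + N * Δ + τ)

variable {c Δ τ : ℝ} {N : ℕ}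

lemma gridPoint_even (hΔ : 0 ≤ Δ) (hτ : 0 ≤ τ) {i : ℕ} (hi : i ≤ N) :
    gridPoint c Δ τ N (2 * i) = c + i * Δ := by
  have : (i : ℝ) * Δ ≤ N * Δ := by gcongr
  rw [gridPoint, Nat.mul_div_cancel_left _ two_pos, Nat.mul_mod_right, min_eq_left]
  · simp
  · simp; linarith

lemma gridPoint_odd (hΔ : 0 ≤ Δ) {i : ℕ} (hi : i ≤ N) :
    gridPoint c Δ τ N (2 * i + 1) = c + i * Δ + τ := by
  have : (i : ℝ) * Δ ≤ N * Δ := by gcongr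
  rw [gridPoint, show (2 * i + 1) / 2 = i by omega, show (2 * i + 1) % 2 = 1 by omega, min_eq_left]
  · simp
  · simp; linarith

lemma gridPoint_succ (hτ : 0 ≤ τ) (hτΔ : τ ≤ Δ) (j : ℕ) :
    gridPoint c Δ τ N j ≤ gridPoint c Δ τ N (j + 1) ∧
      gridPoint c Δ τ N (j + 1) - gridPoint c Δ τ N j ≤ Δ := by
  have key : ∀ {a b m : ℝ}, a ≤ b → b - a ≤ Δ → min a m ≤ min b m ∧ min b m - min a m ≤ Δ := by
    intro a b m hab hd
    refine ⟨min_le_min_right _ hab, ?_⟩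
    rcases le_total a m with h | h
    · rw [min_eq_left h]; linarith [min_le_left b m]
    · rw [min_eq_right h]; linarith [min_le_right b m]
  rcases Nat.even_or_odd' j with ⟨k, rfl | rfl⟩
  · refine key ?_ ?_ <;>
    rw [Nat.mul_div_cancel_left _ two_pos, Nat.mul_mod_right,
      show (2 * k + 1) / 2 = k by omega, show (2 * k + 1) % 2 = 1 by omega] <;>
    push_cast <;> linarith
  · refine key ?_ ?_ <;>
    rw [show (2 * k + 1) / 2 = k by omega, show (2 * k + 1) % 2 = 1 by omega,
      show (2 * k + 1 + 1) / 2 = k + 1 by omega, show (2 * k + 1 + 1) % 2 = 0 by omega] <;>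
    push_cast <;> linarith

lemma gridPoint_monotone (hτ : 0 ≤ τ) (hτΔ : τ ≤ Δ) : Monotone (gridPoint c Δ τ N) :=
  monotone_nat_of_le_succ fun j ↦ (gridPoint_succ hτ hτΔ j).1

/-- Stopping the grid keeps the whole infinite sequence in the time set of the Brownian motion. The
cells after the stopping point have length zero, and the first `N` products do not use them. -/
lemma gridPoint_mem (hτ : 0 ≤ τ) (hτΔ : τ ≤ Δ) (j : ℕ) :
    gridPoint c Δ τ N j ∈ Set.Icc c (c + N * Δ + τ) := by
  refine ⟨?_, min_le_right _ _⟩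
  have := gridPoint_monotone (c := c) (N := N) hτ hτΔ j.zero_le
  have h0 := gridPoint_even (c := c) (hτ.trans hτΔ) hτ N.zero_le
  simp only [mul_zero, Nat.cast_zero, zero_mul, add_zero] at h0
  linarith

end Grid

/-! ### Normalized products on the merged grid and the limit of their characteristic functions. -/

section Clt

variable {Ω : Type*} {mΩ : MeasurableSpace Ω} {P : Measure Ω}

lemma hat_of_abs_le {x Δ : ℝ} (hΔ : 0 < Δ) (hx : |x| ≤ Δ) : hat (Δ⁻¹ * x) = 1 - |x| / Δ := by
  have : |Δ⁻¹ * x| = |x| / Δ := by rw [abs_mul, abs_of_pos (inv_pos.2 hΔ)]; ring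
  rw [hat, this, if_pos ((div_le_one hΔ).2 hx)]

lemma exists_isOneDependent_of_nonneg {S : Set ℝ} {ρ : ℝ} (hρ : ρ ^ 2 ≤ 1) {B B' : ℝ → Ω → ℝ}
    (hG : ∀ t : ℕ → ℝ, Monotone t → (∀ j, t j ∈ S) →
      IsGaussianArray P ρ (fun j ↦ t (j + 1) - t j) (fun j ω ↦ B (t (j + 1)) ω - B (t j) ω)
        (fun j ω ↦ B' (t (j + 1)) ω - B' (t j) ω))
    {c Δ τ : ℝ} {N : ℕ} (hΔ : 0 < Δ) (hτ : 0 ≤ τ) (hτΔ : τ ≤ Δ)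
    (hS : Set.Icc c (c + N * Δ + τ) ⊆ S) :
    ∃ X : ℕ → Ω → ℝ,
      IsOneDependent P X N (1 + ρ ^ 2 * hat (Δ⁻¹ * τ) ^ 2) (256 * sixthMoment + 4) ∧
      ∀ i < N, ∀ ω, X i ω = Δ⁻¹ *
        ((B (c + (i + 1) * Δ) ω - B (c + i * Δ) ω) *
          (B' (c + τ + (i + 1) * Δ) ω - B' (c + τ + i * Δ) ω) - ρ * Δ * hat (Δ⁻¹ * τ)) := by
  set t := gridPoint c Δ τ N with ht
  have H := hG t (gridPoint_monotone hτ hτΔ) fun j ↦ hS (gridPoint_mem hτ hτΔ j)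
  have hat_eq : hat (Δ⁻¹ * τ) = 1 - τ / Δ := by
    rw [hat_of_abs_le hΔ (by rwa [abs_of_nonneg hτ]), abs_of_nonneg hτ]
  have g0 : ∀ i < N, t (2 * i) = c + i * Δ := fun i hi ↦ gridPoint_even hΔ.le hτ hi.le
  have g1 : ∀ i < N, t (2 * i + 1) = c + i * Δ + τ := fun i hi ↦ gridPoint_odd hΔ.le hi.le
  have g2 : ∀ i < N, t (2 * i + 1 + 1) = c + (i + 1) * Δ := fun i hi ↦ by
    have := gridPoint_even (c := c) hΔ.le hτ (Nat.succ_le_of_lt hi)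
    push_cast at this
    exact this
  have g3 : ∀ i < N, t (2 * i + 2 + 1) = c + (i + 1) * Δ + τ := fun i hi ↦ by
    have := gridPoint_odd (c := c) (τ := τ) hΔ.le (Nat.succ_le_of_lt hi)
    push_cast at this
    exact this
  refine ⟨_, H.isOneDependent (N := N) hρ (fun j ↦ (gridPoint_succ hτ hτΔ j).2)
    (inv_nonneg.2 hΔ.le) (inv_mul_cancel₀ hΔ.ne') ?_, ?_⟩
  -- The three cells have lengths `τ`, `Δ - τ`, `τ`, so both factors have variance `Δ` and the
  -- overlap is `Δ - τ = Δ φ`.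
  · intro i hi
    simp only [show 2 * i + 2 = 2 * i + 1 + 1 from rfl]
    rw [show t (2 * i + 1 + 1 + 1) = _ from g3 i hi, g2 i hi, g1 i hi, g0 i hi, hat_eq]
    field_simp
    ring
  · intro i hi ω
    simp only [overlapTerm, show 2 * i + 2 = 2 * i + 1 + 1 from rfl]
    rw [show t (2 * i + 1 + 1 + 1) = _ from g3 i hi, g2 i hi, g1 i hi, g0 i hi, hat_eq,
      show c + τ + (i + 1) * Δ = c + (i + 1) * Δ + τ by ring,
      show c + τ + i * Δ = c + i * Δ + τ by ring]
    field_simp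
    ring

/-- For `τ ≤ 0` the other grid comes first: the two motions are exchanged and the base point becomes
`c + τ`. The hat function is even. -/
lemma exists_isOneDependent {S : Set ℝ} {ρ : ℝ} (hρ : ρ ^ 2 ≤ 1) {B B' : ℝ → Ω → ℝ}
    (hG : ∀ t : ℕ → ℝ, Monotone t → (∀ j, t j ∈ S) →
      IsGaussianArray P ρ (fun j ↦ t (j + 1) - t j) (fun j ω ↦ B (t (j + 1)) ω - B (t j) ω)
        (fun j ω ↦ B' (t (j + 1)) ω - B' (t j) ω))
    {a b : ℝ} (hS : Set.Icc a b ⊆ S) {c Δ τ : ℝ} {N : ℕ} (hΔ : 0 < Δ) (hτΔ : |τ| ≤ Δ)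
    (hc : a ≤ c) (hcτ : a ≤ c + τ) (hN : c + N * Δ ≤ b) (hNτ : c + τ + N * Δ ≤ b) :
    ∃ X : ℕ → Ω → ℝ,
      IsOneDependent P X N (1 + ρ ^ 2 * hat (Δ⁻¹ * τ) ^ 2) (256 * sixthMoment + 4) ∧
      ∀ i < N, ∀ ω, X i ω = Δ⁻¹ *
        ((B (c + (i + 1) * Δ) ω - B (c + i * Δ) ω) *
          (B' (c + τ + (i + 1) * Δ) ω - B' (c + τ + i * Δ) ω) - ρ * Δ * hat (Δ⁻¹ * τ)) := by
  rcases le_total 0 τ with hτ | hτ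
  · refine exists_isOneDependent_of_nonneg hρ hG hΔ hτ ((le_abs_self _).trans hτΔ)
      ((Set.Icc_subset_Icc hc ?_).trans hS)
    linarith
  · obtain ⟨X, hX, hXe⟩ := exists_isOneDependent_of_nonneg (c := c + τ) (N := N) hρ
      (fun t ht htS ↦ (hG t ht htS).symm) hΔ (neg_nonneg.2 hτ) ((neg_le_abs _).trans hτΔ)
      ((Set.Icc_subset_Icc hcτ (by linarith)).trans hS)
    have hh : hat (Δ⁻¹ * -τ) = hat (Δ⁻¹ * τ) := by
      simp only [hat, mul_neg, abs_neg]
    rw [hh] at hX hXe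
    refine ⟨X, hX, fun i hi ω ↦ ?_⟩
    rw [hXe i hi ω, show c + τ + -τ = c by ring]
    ring

lemma tendsto_natFloor_div_mul {T : ℝ} (hT : 0 ≤ T) {Δ : ℕ → ℝ} (hΔ : ∀ n, 0 < Δ n)
    (hΔ0 : Tendsto Δ atTop (𝓝 0)) :
    Tendsto (fun n ↦ (⌊T / Δ n⌋₊ : ℝ) * Δ n) atTop (𝓝 T) := by
  have h1 : Tendsto (fun n ↦ T - Δ n) atTop (𝓝 T) := by
    simpa using tendsto_const_nhds.sub hΔ0
  refine tendsto_of_tendsto_of_tendsto_of_le_of_le h1 tendsto_const_nhds (fun n ↦ ?_) (fun n ↦ ?_)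
  · have := Nat.lt_floor_add_one (T / Δ n)
    rw [div_lt_iff₀ (hΔ n)] at this
    simp only
    linarith
  · have := Nat.floor_le (div_nonneg hT (hΔ n).le)
    rwa [le_div_iff₀ (hΔ n)] at this

lemma tendsto_integral_cexp_of_isOneDependent [IsProbabilityMeasure P] {T : ℝ} (hT : 0 < T)
    {Δ : ℕ → ℝ} (hΔ : ∀ n, 0 < Δ n) (hΔ0 : Tendsto Δ atTop (𝓝 0)) {X : ℕ → ℕ → Ω → ℝ}
    {v : ℕ → ℝ} {K : ℝ} (hK : 0 ≤ K) (hv1 : ∀ n, 1 ≤ v n) (hv2 : ∀ n, v n ≤ 2)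
    (h : ∀ n, IsOneDependent P (X n) ⌊T / Δ n⌋₊ (v n) K) (t : ℝ) :
    Tendsto (fun n ↦ ∫ ω, Complex.exp (Complex.I * ((t * (√(Δ n) / (√T * √(v n)))) *
        ∑ i ∈ Finset.range ⌊T / Δ n⌋₊, X n i ω : ℝ)) ∂P) atTop
      (𝓝 (Complex.exp (-(t ^ 2) / 2))) := by
  set N : ℕ → ℕ := fun n ↦ ⌊T / Δ n⌋₊ with hN
  -- Here `v u² = w²` exactly, so the varying variance drops out of the exponent; `|u| ≤ w` since `v
  -- ≥ 1`, and `N w² ≤ t²` absorbs the number of terms.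
  set w : ℕ → ℝ := fun n ↦ |t| * √(Δ n / T) with hw
  set u : ℕ → ℝ := fun n ↦ t * (√(Δ n) / (√T * √(v n))) with hu
  have hw0 : Tendsto w atTop (𝓝 0) := by
    have : Tendsto (fun n ↦ |t| * √(Δ n / T)) atTop (𝓝 (|t| * √(0 / T))) :=
      ((hΔ0.div_const T).sqrt).const_mul _
    simpa using this
  have hwn : ∀ n, 0 ≤ w n := fun n ↦ by positivity
  have hw2 : ∀ n, w n ^ 2 = t ^ 2 * (Δ n / T) := fun n ↦ by
    simp only [hw, mul_pow, sq_abs]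
    rw [Real.sq_sqrt (div_nonneg (hΔ n).le hT.le)]
  have hvu : ∀ n, v n * u n ^ 2 = w n ^ 2 := fun n ↦ by
    have hvn : 0 < v n := by linarith [hv1 n]
    rw [hw2]
    simp only [hu, mul_pow, div_pow]
    rw [Real.sq_sqrt (hΔ n).le, Real.sq_sqrt hT.le, Real.sq_sqrt hvn.le]
    field_simp
  have huw : ∀ n, |u n| ≤ w n := fun n ↦ by
    refine abs_le_of_sq_le_sq ?_ (hwn n)
    rw [← hvu]
    nlinarith [hv1 n, sq_nonneg (u n)]
  have hNw : ∀ n, N n * w n ^ 2 = t ^ 2 * ((N n * Δ n) / T) := fun n ↦ by rw [hw2]; ring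
  have hNT : ∀ n, N n * Δ n ≤ T := fun n ↦ by
    have := Nat.floor_le (div_nonneg hT.le (hΔ n).le)
    rwa [le_div_iff₀ (hΔ n)] at this
  have hNw' : ∀ n, N n * w n ^ 2 ≤ t ^ 2 := fun n ↦ by
    rw [hNw]
    exact mul_le_of_le_one_right (sq_nonneg t) ((div_le_one hT).2 (hNT n))
  have hexp : Tendsto (fun n ↦ ((Real.exp (-(N n * (v n * u n ^ 2 / 2))) : ℝ) : ℂ)) atTop
      (𝓝 (Complex.exp (-(t ^ 2) / 2))) := by
    have h1 : Tendsto (fun n ↦ -(t ^ 2 * ((N n * Δ n) / T)) / 2) atTop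
        (𝓝 (-(t ^ 2 * (T / T)) / 2)) :=
      ((((tendsto_natFloor_div_mul hT.le hΔ hΔ0).div_const T).const_mul _).neg).div_const 2
    rw [div_self hT.ne', mul_one] at h1
    have h2 : Tendsto (fun n ↦ Real.exp (-(N n * (v n * u n ^ 2 / 2)))) atTop
        (𝓝 (Real.exp (-(t ^ 2) / 2))) := by
      refine ((Real.continuous_exp.tendsto _).comp h1).congr fun n ↦ ?_
      simp only [Function.comp]
      rw [hvu, ← hNw]
      ring_nf
    have h3 := (Complex.continuous_ofReal.tendsto _).comp h2
    simpa [Function.comp_def] using h3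
  have hNtop : ∀ᶠ n in atTop, 2 ≤ N n := by
    have : ∀ᶠ n in atTop, Δ n < T / 2 := hΔ0.eventually_lt_const (by linarith)
    filter_upwards [this] with n hn
    refine Nat.le_floor ?_
    rw [le_div_iff₀ (hΔ n)]
    push_cast
    linarith
  -- After `N w² ≤ t²` is used, the accumulated error is bounded by a polynomial in `w` without
  -- constant term.
  have hb0 : Tendsto (fun n ↦ 2 * w n * (1 + K) + w n ^ 2
      + t ^ 2 * w n * (30 * K + 2 * (1 + K)) + t ^ 2 * w n ^ 2 / 4) atTop (𝓝 0) := by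
    have : Continuous (fun x : ℝ ↦ 2 * x * (1 + K) + x ^ 2
      + t ^ 2 * x * (30 * K + 2 * (1 + K)) + t ^ 2 * x ^ 2 / 4) := by fun_prop
    simpa [Function.comp_def] using (this.tendsto 0).comp hw0
  have hdiff : Tendsto (fun n ↦ (∫ ω, Complex.exp (Complex.I * (u n *
        ∑ i ∈ Finset.range (N n), X n i ω : ℝ)) ∂P)
        - ((Real.exp (-(N n * (v n * u n ^ 2 / 2))) : ℝ) : ℂ)) atTop (𝓝 0) := by
    refine squeeze_zero_norm' ?_ hb0
    filter_upwards [hNtop] with n hn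
    obtain ⟨k, hk⟩ := Nat.exists_eq_add_of_le' hn
    have hv0 : 0 ≤ v n := by linarith [hv1 n]
    have := (h n).norm_integral_cexp_sub_le hv0 (u n) (k := k) hk.ge
    rw [← hk] at this
    refine this.trans ?_
    rw [hvu]
    have hk' : (k : ℝ) ≤ N n := by rw [hk]; push_cast; linarith
    have hkw : k * w n ^ 2 ≤ t ^ 2 :=
      (mul_le_mul_of_nonneg_right hk' (sq_nonneg _)).trans (hNw' n)
    have e1 : 2 * |u n| * (1 + K) ≤ 2 * w n * (1 + K) := by
      have := huw n
      gcongr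
    have e2 : |u n| ^ 3 * (30 * K + v n * (1 + K)) ≤ w n ^ 3 * (30 * K + 2 * (1 + K)) := by
      have := huw n
      have := hv2 n
      have := hwn n
      gcongr
    have e3 : k * (w n ^ 3 * (30 * K + 2 * (1 + K))) ≤ t ^ 2 * w n * (30 * K + 2 * (1 + K)) := by
      calc _ = k * w n ^ 2 * (w n * (30 * K + 2 * (1 + K))) := by ring
        _ ≤ t ^ 2 * (w n * (30 * K + 2 * (1 + K))) := by
          have := hwn n
          gcongr
        _ = _ := by ring
    have e4 : k * (w n ^ 2 / 2) ^ 2 ≤ t ^ 2 * w n ^ 2 / 4 := by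
      calc _ = k * w n ^ 2 * (w n ^ 2 / 4) := by ring
        _ ≤ t ^ 2 * (w n ^ 2 / 4) := by gcongr
        _ = _ := by ring
    have e5 := mul_le_mul_of_nonneg_left e2 (Nat.cast_nonneg (α := ℝ) k)
    rw [mul_add]
    linarith
  have := hdiff.add hexp
  simp only [sub_add_cancel, zero_add] at this
  exact this

end Clt

/-! ### The two contrasts as sums over the grid. -/

section Sums

variable {Ω : Type*} {T δ Δ : ℝ}

lemma sum_equispaced (hΔ : 0 < Δ) (L : ℝ) (f : ℝ × ℝ → ℝ) :
    ∑ I ∈ equispaced Δ L, f I =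
      ∑ i ∈ Finset.range ⌊L / Δ⌋₊, f ((i : ℝ) * Δ, ((i : ℝ) + 1) * Δ) := by
  rw [equispaced, Finset.sum_image]
  intro i _ j _ hij
  have := congrArg Prod.fst hij
  simpa [hΔ.ne'] using this

lemma succ_mul_le_iff (hΔ : 0 < Δ) (hT : 0 ≤ T) (i : ℕ) :
    ((i : ℝ) + 1) * Δ ≤ T ↔ i < ⌊T / Δ⌋₊ := by
  rw [← Nat.succ_le_iff, Nat.le_floor_iff (div_nonneg hT hΔ.le), le_div_iff₀ hΔ]
  push_cast
  rfl

lemma sum_range_ite_le (hΔ : 0 < Δ) (hT : 0 ≤ T) (hδ : 0 ≤ δ) (f : ℕ → ℝ) :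
    ∑ i ∈ Finset.range ⌊(T + δ) / Δ⌋₊, (if ((i : ℝ) + 1) * Δ ≤ T then f i else 0) =
      ∑ i ∈ Finset.range ⌊T / Δ⌋₊, f i := by
  have hle : ⌊T / Δ⌋₊ ≤ ⌊(T + δ) / Δ⌋₊ := Nat.floor_mono (by gcongr; linarith)
  rw [← Finset.sum_filter]
  congr 1
  ext i
  simp only [Finset.mem_filter, Finset.mem_range, succ_mul_le_iff hΔ hT]
  omega

lemma Ioc_inter_Ioc_shift_nonempty_iff (hΔ : 0 < Δ) (i j m : ℕ) :
    (Set.Ioc ((i : ℝ) * Δ) (((i : ℝ) + 1) * Δ) ∩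
      Set.Ioc ((j : ℝ) * Δ + -(m * Δ)) (((j : ℝ) + 1) * Δ + -(m * Δ))).Nonempty ↔ j = i + m := by
  rw [Set.Ioc_inter_Ioc, Set.nonempty_Ioc, max_lt_iff, lt_min_iff, lt_min_iff]
  constructor
  · rintro ⟨⟨-, h1⟩, h2, -⟩
    have h1' : (i : ℝ) < j + 1 - m := lt_of_mul_lt_mul_right (by linarith) hΔ.le
    have h2' : (j : ℝ) - m < i + 1 := lt_of_mul_lt_mul_right (by linarith) hΔ.le
    have h1'' : ((i + m : ℕ) : ℝ) < (j + 1 : ℕ) := by push_cast; linarith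
    have h2'' : (j : ℝ) < (i + m + 1 : ℕ) := by push_cast; linarith
    rw [Nat.cast_lt] at h1'' h2''
    omega
  · rintro rfl
    push_cast
    refine ⟨⟨?_, ?_⟩, ?_, ?_⟩ <;> nlinarith

/-- For each `i` only `j = i + m` survives, and `m Δ ≤ δ` ensures that this interval is still
observed. The condition is an arbitrary predicate with an arbitrary decidability instance, to match
the classical one in `hyContrast`. -/
lemma sum_overlap (hΔ : 0 < Δ) (hT : 0 ≤ T) (hδ : 0 ≤ δ) {m : ℕ} (hm : m * Δ ≤ δ)
    (A : ℕ → ℕ → Prop) {_ : ∀ i j, Decidable (A i j)}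
    (hA : ∀ i j, A i j ↔ ((i : ℝ) + 1) * Δ ≤ T ∧ (Set.Ioc ((i : ℝ) * Δ) (((i : ℝ) + 1) * Δ) ∩
      Set.Ioc ((j : ℝ) * Δ + -(m * Δ)) (((j : ℝ) + 1) * Δ + -(m * Δ))).Nonempty)
    (F : ℕ → ℕ → ℝ) :
    ∑ i ∈ Finset.range ⌊(T + δ) / Δ⌋₊, ∑ j ∈ Finset.range ⌊(T + δ) / Δ⌋₊,
        (if A i j then F i j else 0) = ∑ i ∈ Finset.range ⌊T / Δ⌋₊, F i (i + m) := by
  rw [← sum_range_ite_le hΔ hT hδ]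
  refine Finset.sum_congr rfl fun i _ ↦ ?_
  simp only [hA, Ioc_inter_Ioc_shift_nonempty_iff hΔ]
  split_ifs with hi
  · rw [Finset.sum_eq_single (i + m)]
    · simp [hi]
    · intro j _ hj
      simp [hj]
    · intro h
      refine absurd (Finset.mem_range.2 ?_) h
      rw [← succ_mul_le_iff hΔ (by linarith)]
      push_cast
      linarith
  · simp [hi]

lemma shiftedCovariation_of_nonneg (hΔ : 0 < Δ) (hT : 0 ≤ T) (hδ : 0 ≤ δ) (X Y : ℝ → Ω → ℝ)
    {θ : ℝ} (hθ : 0 ≤ θ) (ω : Ω) :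
    shiftedCovariation T (equispaced Δ (T + δ)) X Y θ ω =
      ∑ i ∈ Finset.range ⌊T / Δ⌋₊, (X ((i + 1) * Δ) ω - X (i * Δ) ω) *
        (Y ((i + 1) * Δ + θ) ω - Y (i * Δ + θ) ω) := by
  rw [shiftedCovariation, if_pos hθ, sum_equispaced hΔ]
  exact sum_range_ite_le hΔ hT hδ fun i ↦ (X ((i + 1) * Δ) ω - X (i * Δ) ω) *
        (Y ((i + 1) * Δ + θ) ω - Y (i * Δ + θ) ω)

lemma shiftedCovariation_of_neg (hΔ : 0 < Δ) (hT : 0 ≤ T) (hδ : 0 ≤ δ) (X Y : ℝ → Ω → ℝ)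
    {θ : ℝ} (hθ : θ < 0) (ω : Ω) :
    shiftedCovariation T (equispaced Δ (T + δ)) X Y θ ω =
      ∑ i ∈ Finset.range ⌊T / Δ⌋₊, (X ((i + 1) * Δ + -θ) ω - X (i * Δ + -θ) ω) *
        (Y ((i + 1) * Δ) ω - Y (i * Δ) ω) := by
  rw [shiftedCovariation, if_neg hθ.not_ge, sum_equispaced hΔ]
  exact sum_range_ite_le hΔ hT hδ fun i ↦ (X ((i + 1) * Δ + -θ) ω - X (i * Δ + -θ) ω) *
        (Y ((i + 1) * Δ) ω - Y (i * Δ) ω)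

/-- If the shift is a multiple of the sampling step, then the Hayashi-Yoshida contrast is the
shifted realized covariation. -/
lemma hyContrast_eq_shiftedCovariation (hΔ : 0 < Δ) (hT : 0 ≤ T) (hδ : 0 ≤ δ) (X Y : ℝ → Ω → ℝ)
    {θ : ℝ} (hθ : |θ| ≤ δ) (hk : ∃ k : ℤ, θ = k * Δ) (ω : Ω) :
    hyContrast T (equispaced Δ (T + δ)) (equispaced Δ (T + δ)) X Y θ ω =
      shiftedCovariation T (equispaced Δ (T + δ)) X Y θ ω := by
  obtain ⟨k, hk⟩ := hk
  rcases le_or_gt 0 θ with h | h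
  · obtain ⟨m, rfl⟩ : ∃ m : ℕ, k = m := by
      refine Int.eq_ofNat_of_zero_le ?_
      rw [hk] at h
      exact_mod_cast nonneg_of_mul_nonneg_left h hΔ
    have hk : θ = m * Δ := by simpa using hk
    rw [shiftedCovariation_of_nonneg hΔ hT hδ X Y h, hyContrast, if_pos h, sum_equispaced hΔ]
    simp_rw [sum_equispaced hΔ]
    refine (sum_overlap hΔ hT hδ (m := m) (by rw [← hk]; exact (le_abs_self _).trans hθ) _
      (fun i j ↦ by simp only [shiftInterval, hk]) _).trans (Finset.sum_congr rfl fun i _ ↦ ?_)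
    simp only [increment, hk]
    push_cast
    ring_nf
  · obtain ⟨m, hm⟩ : ∃ m : ℕ, -k = m := by
      refine Int.eq_ofNat_of_zero_le ?_
      rw [hk] at h
      have : (k : ℝ) < 0 := by
        by_contra hc
        exact absurd h (mul_nonneg (not_lt.1 hc) hΔ.le).not_gt
      have : k < 0 := by exact_mod_cast this
      omega
    have hk : θ = -(m * Δ) := by
      have : (k : ℝ) = -m := by exact_mod_cast (by omega : k = -(m : ℤ))
      rw [hk, this]; ring
    -- For a negative shift the cut-off at `T` bears on `J`, so `J` must become the outer index.
    rw [shiftedCovariation_of_neg hΔ hT hδ X Y h, hyContrast, if_neg h.not_ge, Finset.sum_comm,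
      sum_equispaced hΔ]
    simp_rw [sum_equispaced hΔ]
    refine (sum_overlap hΔ hT hδ (m := m) ?_ _
      (fun i j ↦ by simp only [shiftInterval, hk]) _).trans (Finset.sum_congr rfl fun i _ ↦ ?_)
    · have := (neg_le_abs θ).trans hθ
      rw [hk] at this
      linarith
    · simp only [increment, hk]
      push_cast
      ring_nf

/-- In the Bachelier model the shifted covariation is, up to the factor `σ₁ σ₂`, a sum of products
of Brownian increments over two grids that differ by the shift `θ - ϑ`. -/
lemma exists_shiftedCovariation_eq (hΔ : 0 < Δ) (hT : 0 ≤ T) (hδ : 0 ≤ δ)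
    {σ₁ σ₂ x₀ y₀ ϑ θ : ℝ} (hϑ : ϑ ∈ Set.Ioo (-δ) δ) (hθ : θ ∈ Set.Ioo (-δ) δ)
    {X Y B₁ B₂ : ℝ → Ω → ℝ}
    (hX : ∀ t ∈ Set.Icc 0 (T + δ), X t = bachelierX x₀ σ₁ ϑ B₁ t)
    (hY : ∀ t ∈ Set.Icc 0 (T + δ), Y t = bachelierY y₀ σ₂ ϑ B₂ t) :
    ∃ c : ℝ, -δ ≤ c ∧ -δ ≤ c + (θ - ϑ) ∧ c + (⌊T / Δ⌋₊ : ℝ) * Δ ≤ T + δ ∧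
      c + (θ - ϑ) + (⌊T / Δ⌋₊ : ℝ) * Δ ≤ T + δ ∧
      ∀ ω, shiftedCovariation T (equispaced Δ (T + δ)) X Y θ ω = σ₁ * σ₂ *
        ∑ i ∈ Finset.range ⌊T / Δ⌋₊, (B₁ (c + (i + 1) * Δ) ω - B₁ (c + i * Δ) ω) *
          (B₂ (c + (θ - ϑ) + (i + 1) * Δ) ω - B₂ (c + (θ - ϑ) + i * Δ) ω) := by
  -- The delays of `Y` and `X` are the positive and negative parts of `ϑ`, so the relative shift of
  -- the two Brownian grids is `θ - ϑ` for all signs.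
  have hmax : max ϑ 0 - max (-ϑ) 0 = ϑ := by
    rcases le_total 0 ϑ with h | h
    · rw [max_eq_left h, max_eq_right (by linarith)]; ring
    · rw [max_eq_right h, max_eq_left (by linarith)]; ring
  have hm1 : max ϑ 0 ≤ δ := max_le hϑ.2.le hδ
  have hm2 : max (-ϑ) 0 ≤ δ := max_le (by linarith [hϑ.1]) hδ
  have hp1 : 0 ≤ max ϑ 0 := le_max_right _ _
  have hp2 : 0 ≤ max (-ϑ) 0 := le_max_right _ _
  have hN : (⌊T / Δ⌋₊ : ℝ) * Δ ≤ T := by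
    have := Nat.floor_le (div_nonneg hT hΔ.le)
    rwa [le_div_iff₀ hΔ] at this
  have hi1 : ∀ i ∈ Finset.range ⌊T / Δ⌋₊, ((i : ℝ) + 1) * Δ ≤ T := fun i hi ↦
    (succ_mul_le_iff hΔ hT i).2 (Finset.mem_range.1 hi)
  have hi0 : ∀ i : ℕ, 0 ≤ (i : ℝ) * Δ := fun i ↦ by positivity
  obtain ⟨hθ1, hθ2⟩ := hθ
  rcases le_or_gt 0 θ with h | h
  -- The base point `c` is the Brownian time at which the first increment of `X` starts; for
  -- negative `θ` the observation of `X` is itself advanced by `-θ`.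
  · refine ⟨-max (-ϑ) 0, by linarith, by linarith, by linarith, by linarith, fun ω ↦ ?_⟩
    rw [shiftedCovariation_of_nonneg hΔ hT hδ X Y h, Finset.mul_sum]
    refine Finset.sum_congr rfl fun i hi ↦ ?_
    have h1 := hi1 i hi
    have h0 := hi0 i
    rw [hX _ ⟨by linarith, by linarith⟩, hX _ ⟨by linarith, by linarith⟩,
      hY _ ⟨by linarith, by linarith⟩, hY _ ⟨by linarith, by linarith⟩]
    simp only [bachelierX, bachelierY]
    rw [show (i + 1 : ℝ) * Δ - max (-ϑ) 0 = -max (-ϑ) 0 + (i + 1) * Δ by ring,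
      show (i : ℝ) * Δ - max (-ϑ) 0 = -max (-ϑ) 0 + i * Δ by ring,
      show (i + 1 : ℝ) * Δ + θ - max ϑ 0 = -max (-ϑ) 0 + (θ - ϑ) + (i + 1) * Δ by linarith,
      show (i : ℝ) * Δ + θ - max ϑ 0 = -max (-ϑ) 0 + (θ - ϑ) + i * Δ by linarith]
    ring
  · refine ⟨-θ - max (-ϑ) 0, by linarith, by linarith, by linarith, by linarith, fun ω ↦ ?_⟩
    rw [shiftedCovariation_of_neg hΔ hT hδ X Y h, Finset.mul_sum]
    refine Finset.sum_congr rfl fun i hi ↦ ?_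
    have h1 := hi1 i hi
    have h0 := hi0 i
    rw [hX _ ⟨by linarith, by linarith⟩, hX _ ⟨by linarith, by linarith⟩,
      hY _ ⟨by linarith, by linarith⟩, hY _ ⟨by linarith, by linarith⟩]
    simp only [bachelierX, bachelierY]
    rw [show (i + 1 : ℝ) * Δ + -θ - max (-ϑ) 0 = -θ - max (-ϑ) 0 + (i + 1) * Δ by ring,
      show (i : ℝ) * Δ + -θ - max (-ϑ) 0 = -θ - max (-ϑ) 0 + i * Δ by ring,
      show (i + 1 : ℝ) * Δ - max ϑ 0 = -θ - max (-ϑ) 0 + (θ - ϑ) + (i + 1) * Δ by linarith,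
      show (i : ℝ) * Δ - max ϑ 0 = -θ - max (-ϑ) 0 + (θ - ϑ) + i * Δ by linarith]
    ring

end Sums

/-! ### Convergence in distribution and conclusion. -/

lemma IsCorrelatedBrownian.isGaussianArray {Ω : Type*} {mΩ : MeasurableSpace Ω} {P : Measure Ω}
    [IsProbabilityMeasure P] {𝓕 : Filtration ℝ mΩ} {S : Set ℝ} {ρ : ℝ} {B₁ B₂ : ℝ → Ω → ℝ}
    (hB : IsCorrelatedBrownian P 𝓕 S ρ B₁ B₂) (hρ : ρ ^ 2 ≤ 1) {t : ℕ → ℝ} (ht : Monotone t)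
    (htS : ∀ j, t j ∈ S) :
    IsGaussianArray P ρ (fun j ↦ t (j + 1) - t j) (fun j ω ↦ B₁ (t (j + 1)) ω - B₁ (t j) ω)
      (fun j ω ↦ B₂ (t (j + 1)) ω - B₂ (t j) ω) where
  indep := hB.iIndepFun_increments ht htS
  pair j := hB.isGaussianPair hρ (htS j) (htS _) (ht j.le_succ)

lemma charFun_map_affine {Ω : Type*} {mΩ : MeasurableSpace Ω} {P : Measure Ω} {f : Ω → ℝ}
    (hf : AEMeasurable f P) (r d t : ℝ) :
    charFun (P.map (fun ω ↦ r * f ω + d)) t =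
      (∫ ω, Complex.exp (Complex.I * (t * r * f ω : ℝ)) ∂P) *
        Complex.exp (Complex.I * (t * d : ℝ)) := by
  rw [charFun_apply_real, integral_map (by fun_prop) (by fun_prop), ← integral_mul_const]
  congr 1
  funext ω
  rw [← Complex.exp_add]
  push_cast
  ring_nf

/-- An affine function of sums of one-dependent arrays, with the scaling of the central limit
theorem and an asymptotically negligible shift, is asymptotically standard Gaussian. -/
lemma tendstoInDistribution_of_isOneDependent {Ω : Type*} {mΩ : MeasurableSpace Ω} {P : Measure Ω}
    [IsProbabilityMeasure P] {T : ℝ} (hT : 0 < T)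
    {Δ : ℕ → ℝ} (hΔ : ∀ n, 0 < Δ n) (hΔ0 : Tendsto Δ atTop (𝓝 0)) {X : ℕ → ℕ → Ω → ℝ}
    {v : ℕ → ℝ} {K : ℝ} (hK : 0 ≤ K) (hv1 : ∀ n, 1 ≤ v n) (hv2 : ∀ n, v n ≤ 2)
    (h : ∀ n, IsOneDependent P (X n) ⌊T / Δ n⌋₊ (v n) K) {d : ℕ → ℝ}
    (hd : Tendsto d atTop (𝓝 0)) :
    TendstoInDistribution (fun n ω ↦ √(Δ n) / (√T * √(v n)) *
        ∑ i ∈ Finset.range ⌊T / Δ n⌋₊, X n i ω + d n) atTop (id : ℝ → ℝ) (fun _ ↦ P)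
      (gaussianReal 0 1) where
  forall_aemeasurable n :=
    ((((h n).measurable_sum _).const_mul _).add_const _).aemeasurable
  tendsto := by
    -- By Lévy's continuity theorem; the deterministic shift only contributes a phase that tends to
    -- `1`.
    refine ProbabilityMeasure.tendsto_iff_tendsto_charFun.2 fun t ↦ ?_
    have h1 := tendsto_integral_cexp_of_isOneDependent hT hΔ hΔ0 hK hv1 hv2 h t
    have h2 : Tendsto (fun n ↦ Complex.exp (Complex.I * (t * d n : ℝ))) atTop (𝓝 1) := by
      have : Continuous fun x : ℝ ↦ Complex.exp (Complex.I * (t * x : ℝ)) := by fun_prop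
      simpa [Function.comp_def] using (this.tendsto 0).comp hd
    have h3 := h1.mul h2
    rw [mul_one] at h3
    have e : charFun ((gaussianReal 0 1).map id) t = Complex.exp (-(t ^ 2) / 2) := by
      rw [Measure.map_id, charFun_gaussianReal]
      simp [neg_div]
    simp only [ProbabilityMeasure.coe_mk]
    rw [e]
    refine h3.congr fun n ↦ ?_
    exact (charFun_map_affine ((h n).measurable_sum _).aemeasurable _ _ t).symm

end LeadLag

theorem proposition1 {Ω : Type*} {mΩ : MeasurableSpace Ω} (P : Measure Ω) [IsProbabilityMeasure P]
    (T δ : ℝ) (hT : 0 < T) (hδ : 0 < δ)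
    (ρ σ₁ σ₂ x₀ y₀ : ℝ) (hρ : ρ ∈ Set.Icc (-1 : ℝ) 1) (hσ₁ : 0 < σ₁) (hσ₂ : 0 < σ₂)
    (𝓕 : Filtration ℝ mΩ) (B₁ B₂ : ℝ → Ω → ℝ)
    (hB : LeadLag.IsCorrelatedBrownian P 𝓕 (Set.Icc (-δ) (T + δ)) ρ B₁ B₂)
    (ϑ : ℝ) (hϑ : ϑ ∈ Set.Ioo (-δ) δ)
    (X Y : ℝ → Ω → ℝ)
    (hX : ∀ t ∈ Set.Icc 0 (T + δ), X t = LeadLag.bachelierX x₀ σ₁ ϑ B₁ t)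
    (hY : ∀ t ∈ Set.Icc 0 (T + δ), Y t = LeadLag.bachelierY y₀ σ₂ ϑ B₂ t)
    (Δ : ℕ → ℝ) (hΔ_pos : ∀ n, 0 < Δ n) (hΔ_lim : Tendsto Δ atTop (𝓝 0))
    (θ : ℕ → ℝ) (hθ_mem : ∀ n, θ n ∈ Set.Ioo (-δ) δ) (hθ : ∀ n, |θ n - ϑ| ≤ Δ n) :
    ∃ ξ : ℕ → Ω → ℝ,
      (∀ n, (∃ k : ℤ, θ n = k * Δ n) → ∀ ω,
        LeadLag.hyContrast T (LeadLag.equispaced (Δ n) (T + δ))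
            (LeadLag.equispaced (Δ n) (T + δ)) X Y (θ n) ω =
          σ₁ * σ₂ * (T * ρ * LeadLag.hat ((Δ n)⁻¹ * (θ n - ϑ)) +
            √T * √(Δ n) * √(1 + ρ ^ 2 * LeadLag.hat ((Δ n)⁻¹ * (θ n - ϑ)) ^ 2) * ξ n ω)) ∧
      (∀ n ω,
        LeadLag.shiftedCovariation T (LeadLag.equispaced (Δ n) (T + δ)) X Y (θ n) ω =
          σ₁ * σ₂ * (T * ρ * LeadLag.hat ((Δ n)⁻¹ * (θ n - ϑ)) +
            √T * √(Δ n) * √(1 + ρ ^ 2 * LeadLag.hat ((Δ n)⁻¹ * (θ n - ϑ)) ^ 2) * ξ n ω)) ∧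
      TendstoInDistribution ξ atTop (id : ℝ → ℝ) (fun _ ↦ P) (gaussianReal 0 1) := by
  have hρ2 : ρ ^ 2 ≤ 1 := (sq_le_one_iff_abs_le_one ρ).2 (abs_le.2 ⟨hρ.1, hρ.2⟩)
  set φ : ℕ → ℝ := fun n ↦ LeadLag.hat ((Δ n)⁻¹ * (θ n - ϑ)) with hφ
  have hφ0 : ∀ n, 0 ≤ φ n ∧ φ n ≤ 1 := fun n ↦ by
    have h1 : |θ n - ϑ| / Δ n ≤ 1 := (div_le_one (hΔ_pos n)).2 (hθ n)
    have h2 : 0 ≤ |θ n - ϑ| / Δ n := div_nonneg (abs_nonneg _) (hΔ_pos n).le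
    simp only [hφ, LeadLag.hat_of_abs_le (hΔ_pos n) (hθ n)]
    constructor <;> linarith
  set v : ℕ → ℝ := fun n ↦ 1 + ρ ^ 2 * φ n ^ 2 with hv
  have hv1 : ∀ n, 1 ≤ v n := fun n ↦ le_add_of_nonneg_right (by positivity)
  have hv2 : ∀ n, v n ≤ 2 := fun n ↦ by
    have h1 : φ n ^ 2 ≤ 1 := pow_le_one₀ (hφ0 n).1 (hφ0 n).2
    have : ρ ^ 2 * φ n ^ 2 ≤ 1 := mul_le_one₀ hρ2 (sq_nonneg _) h1
    simp only [hv]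
    linarith
  set N : ℕ → ℕ := fun n ↦ ⌊T / Δ n⌋₊ with hN
  choose c hc1 hc2 hc3 hc4 hV using fun n ↦ LeadLag.exists_shiftedCovariation_eq (σ₁ := σ₁)
    (σ₂ := σ₂) (hΔ_pos n) hT.le hδ.le hϑ (hθ_mem n) hX hY
  choose Z hZ hZe using fun n ↦ LeadLag.exists_isOneDependent hρ2
    (fun t ht htS ↦ hB.isGaussianArray hρ2 ht htS) subset_rfl (hΔ_pos n) (hθ n) (hc1 n) (hc2 n)
    (hc3 n) (hc4 n)
  -- The exact mean is proportional to `N Δ` and the statement has `T`. The gap is at most `Δ`, so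
  -- after division by a quantity of order `√Δ` it still vanishes.
  set d : ℕ → ℝ := fun n ↦ ρ * φ n * (N n * Δ n - T) / (√T * √(Δ n) * √(v n)) with hd
  have hTs : 0 < √T := Real.sqrt_pos.2 hT
  have hΔs : ∀ n, 0 < √(Δ n) := fun n ↦ Real.sqrt_pos.2 (hΔ_pos n)
  have hvs : ∀ n, 1 ≤ √(v n) := fun n ↦ Real.one_le_sqrt.2 (hv1 n)
  have hd0 : Tendsto d atTop (𝓝 0) := by
    have hlim : Tendsto (fun n ↦ √(Δ n) / √T) atTop (𝓝 0) := by
      simpa using (hΔ_lim.sqrt).div_const (√T)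
    refine squeeze_zero_norm (fun n ↦ ?_) hlim
    have h1 : |N n * Δ n - T| ≤ Δ n := by
      have a := Nat.lt_floor_add_one (T / Δ n)
      have b := Nat.floor_le (div_nonneg hT.le (hΔ_pos n).le)
      rw [div_lt_iff₀ (hΔ_pos n)] at a
      rw [le_div_iff₀ (hΔ_pos n)] at b
      rw [abs_le]
      constructor <;> simp only [hN] <;> linarith
    have h2 : |ρ * φ n| ≤ 1 := by
      rw [abs_mul, abs_of_nonneg (hφ0 n).1]
      exact mul_le_one₀ (abs_le.2 ⟨hρ.1, hρ.2⟩) (hφ0 n).1 (hφ0 n).2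
    have hpos : 0 < √T * √(Δ n) := mul_pos hTs (hΔs n)
    simp only [hd]
    rw [Real.norm_eq_abs, abs_div, abs_mul,
      abs_of_nonneg (by positivity : 0 ≤ √T * √(Δ n) * √(v n))]
    calc _ ≤ 1 * Δ n / (√T * √(Δ n) * 1) := by
          have := hvs n
          have := (hΔ_pos n).le
          gcongr
      _ = √(Δ n) / √T := by
          have := Real.mul_self_sqrt (hΔ_pos n).le
          rw [div_eq_div_iff (by positivity) hTs.ne']
          linear_combination -√T * this
  have hVξ : ∀ n ω,
      LeadLag.shiftedCovariation T (LeadLag.equispaced (Δ n) (T + δ)) X Y (θ n) ω =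
        σ₁ * σ₂ * (T * ρ * φ n + √T * √(Δ n) * √(v n) *
          (√(Δ n) / (√T * √(v n)) * ∑ i ∈ Finset.range (N n), Z n i ω + d n)) := by
    intro n ω
    have hvn : 0 < √(v n) := one_pos.trans_le (hvs n)
    -- The identity holds for every `ω`: the array `Z` is explicit for all indices below `N`, which
    -- are the only ones summed.
    have hsum : ∑ i ∈ Finset.range (N n), Z n i ω = (Δ n)⁻¹ *
        (∑ i ∈ Finset.range (N n), (B₁ (c n + (i + 1) * Δ n) ω - B₁ (c n + i * Δ n) ω) *
          (B₂ (c n + (θ n - ϑ) + (i + 1) * Δ n) ω - B₂ (c n + (θ n - ϑ) + i * Δ n) ω)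
          - N n * (ρ * Δ n * φ n)) := by
      rw [Finset.sum_congr rfl fun i hi ↦ hZe n i (Finset.mem_range.1 hi) ω, ← Finset.mul_sum,
        Finset.sum_sub_distrib, Finset.sum_const, Finset.card_range, nsmul_eq_mul]
    rw [hV n ω, hsum]
    simp only [hd]
    set W := ∑ i ∈ Finset.range (N n), (B₁ (c n + (i + 1) * Δ n) ω - B₁ (c n + i * Δ n) ω) *
          (B₂ (c n + (θ n - ϑ) + (i + 1) * Δ n) ω - B₂ (c n + (θ n - ϑ) + i * Δ n) ω)
    have hs := Real.sq_sqrt (hΔ_pos n).le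
    have hΔn := (hΔ_pos n).ne'
    have hΔsn := (hΔs n).ne'
    congr 1
    have e1 : √T * √(Δ n) * √(v n) * (√(Δ n) / (√T * √(v n)) *
        ((Δ n)⁻¹ * (W - N n * (ρ * Δ n * φ n)))) = W - N n * (ρ * Δ n * φ n) := by
      calc _ = √(Δ n) ^ 2 * (Δ n)⁻¹ * (W - N n * (ρ * Δ n * φ n)) := by field_simp
        _ = _ := by rw [hs, mul_inv_cancel₀ hΔn, one_mul]
    have e2 : √T * √(Δ n) * √(v n) * (ρ * φ n * (N n * Δ n - T) / (√T * √(Δ n) * √(v n)))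
        = ρ * φ n * (N n * Δ n - T) := by
      field_simp
    rw [mul_add, e1, e2]
    ring
  refine ⟨fun n ω ↦ √(Δ n) / (√T * √(v n)) * ∑ i ∈ Finset.range (N n), Z n i ω + d n,
    fun n hk ω ↦ ?_, hVξ, ?_⟩
  · rw [LeadLag.hyContrast_eq_shiftedCovariation (hΔ_pos n) hT.le hδ.le X Y
      (abs_le.2 ⟨(hθ_mem n).1.le, (hθ_mem n).2.le⟩) hk]
    exact hVξ n ω
  · have hK : 0 ≤ 256 * LeadLag.sixthMoment + 4 := by
      have := LeadLag.sixthMoment_nonneg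
      linarith
    exact LeadLag.tendstoInDistribution_of_isOneDependent hT hΔ_pos hΔ_lim hK hv1 hv2 hZ hd0
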